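/- Work over $\mathbb C$. An ind-group is a group $G$ with a filtration $G_1\subseteq G_2\subseteq\dots$ exhausting $G$ by affine varieties (possibly reducible), each a closed subvariety of the next, such that $(g,h)\mapsto gh^{-1}$ is a morphism of ind-varieties; a subset of $G$ is closed if its intersection with every $G_i$ is closed in $G_i$, and a closed subgroup carries the induced structure. The group $\mathrm{Aut}(\mathbb A^n)$ is an ind-group through the filtration by degree, where automorphisms of degree $\le i$ form a variety through the pairs $(g,g^{-1})$, i.e. with regular functions the polynomials in the coefficients of $g$ and $g^{-1}$. Write $g^*$ for the comorphism of an automorphism $g$. For a locally nilpotent derivation $D$ of $\mathcal O(\mathbb A^3)=\mathbb C[x_1,x_2,x_3]$ let $\mathrm{Exp}(D)$ be the automorphism of $\mathbb A^3$ with comorphism $\sum_i D^i/i!$; such automorphisms are called unipotent. For $\mathbf u=\mathrm{Exp}(D)$ the ring $\mathcal O(\mathbb A^3)^{\mathbf u}$ of $\mathbf u$-invariant polynomials is $\ker D$; for $f\in\ker D$ put $f\cdot\mathbf u=\mathrm{Exp}(fD)$ (a modification of $\mathbf u$), and let $\mathcal O(\mathbb A^3)^{\mathbf u}\cdot\mathbf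 u$ be the group of all these modifications. A unipotent $\mathbf u\ne\mathbf{id}$ is irreducible if $\mathbf u=f\cdot\mathbf u''$ with $\mathbf u''$ unipotent and $f \in \mathcal O(\mathbb A^3)^{\mathbf u''}$ forces $f\in\mathbb C^*$; a standard decomposition of $\mathbf u$ is an equation $\mathbf u=d\cdot\mathbf u'$ with $\mathbf u'$ irreducible and $d\in\mathcal O(\mathbb A^3)^{\mathbf u'}$. A translation is an automorphism of the form $(x,y,z)\mapsto(x+1,y,z)$ in suitable coordinates of $\mathbb A^3$, and a modified translation is a modification of a translation. Let $\mathbb A^3/\!\!/\mathbb G_a=\mathrm{Spec}\,\mathcal O(\mathbb A^3)^{\mathbf u}$. The plinth divisor $\Gamma$ of $\mathbf u=\mathrm{Exp}(D)$ is the closed subscheme of $\mathbb A^3/\!\!/\mathbb G_a$ defined by the ideal $\mathrm{im}\,D\cap\ker D$ of $\ker D$, and $\mathrm{Aut}(\mathbb A^3/\!\!/\mathbb G_a,\Gamma)$ is the group of automorphisms of $\mathbb A^3/\!\!/\mathbb G_a$ whose scheme-theoretic image of $\Gamma$ is $\Gamma$. Let $\mathrm{Cent}(\mathbf u)$ be the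 centralizer of $\mathbf u$ in $\mathrm{Aut}(\mathbb A^3)$, and for $\mathbf g\in\mathrm{Cent}(\mathbf u)$ let $p(\mathbf g)$ be the automorphism of $\mathbb A^3/\!\!/\mathbb G_a$ with comorphism $\mathbf g^*|_{\mathcal O(\mathbb A^3)^{\mathbf u}}$. **Proposition.** Let $\mathbf{id}\ne\mathbf u\in\mathrm{Aut}(\mathbb A^3)$ be a modified translation with standard decomposition $\mathbf u=d\cdot\mathbf u'$ and plinth divisor $\Gamma$. Then $\mathbb A^3/\!\!/\mathbb G_a\cong\mathbb A^2$, the ideal of $\Gamma$ is principal and non-zero, and, for the ind-group structure on $\mathrm{Aut}(\mathbb A^3/\!\!/\mathbb G_a)$ obtained from $\mathrm{Aut}(\mathbb A^2)$ by any isomorphism $\mathbb A^3/\!\!/\mathbb G_a\cong\mathbb A^2$, $$1\to\mathcal O(\mathbb A^3)^{\mathbf u'}\cdot\mathbf u'\hookrightarrow\mathrm{Cent}(\mathbf u)\xrightarrow{\;p\;}\mathrm{Aut}(\mathbb A^3/\!\!/\mathbb G_a,\Gamma)\to1$$ is a split short exact sequence of ind-groups (with the structures induced from $\mathrm{Aut}(\mathbb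 A^3)$ and $\mathrm{Aut}(\mathbb A^3/\!\!/\mathbb G_a)$): the three groups are ind-groups, the first map is an isomorphism of ind-groups onto a closed subgroup, which is the kernel of $p$, and $p$ is a surjective homomorphism of ind-groups that has a section which is a homomorphism of ind-groups. Moreover, there is a closed subgroup of $\mathrm{Cent}(\mathbf u)$ that $p$ maps isomorphically, as ind-groups, onto $\mathrm{Aut}(\mathbb A^3/\!\!/\mathbb G_a,\Gamma)$. Furthermore, $\mathbf u$ is a translation if and only if $\Gamma=\varnothing$, and in that case $\mathrm{Aut}(\mathbb A^3/\!\!/\mathbb G_a,\Gamma)=\mathrm{Aut}(\mathbb A^3/\!\!/\mathbb G_a)$ and $\mathcal O(\mathbb A^3)^{\mathbf u'}\cdot\mathbf u'=\mathcal O(\mathbb A^3)^{\mathbf u}\cdot\mathbf u$, so that the sequence reads $1\to\mathcal O(\mathbb A^3)^{\mathbf u}\cdot\mathbf u\hookrightarrow\mathrm{Cent}(\mathbf u)\to\mathrm{Aut}(\mathbb A^3/\!\!/\mathbb G_a)\to1$. -/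

import Mathlib

open MvPolynomial

noncomputable section

namespace IndAut

/-! ### Affine varieties, ind-varieties and ind-groups over `ℂ`

A (possibly reducible) affine variety is a set `X` with its `ℂ`-algebra of regular functions. -/

/-- Pullback of complex functions along a map, as an algebra homomorphism. -/
def pullback {X Y : Type*} (f : X → Y) : (Y → ℂ) →ₐ[ℂ] (X → ℂ) where
  toFun φ := φ ∘ f
  map_one' := rfl
  map_mul' _ _ := rfl
  map_zero' := rfl
  map_add' _ _ := rfl
  commutes' _ := rfl

/-- `X`, with `A` as algebra of regular functions, is an affine variety: finitely many generators
of `A` identify `X` with the zero set in some `ℂⁿ` of a set of polynomials. -/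
def IsAffineVariety {X : Type*} (A : Subalgebra ℂ (X → ℂ)) : Prop :=
  ∃ (n : ℕ) (c : Fin n → X → ℂ),
    A = Algebra.adjoin ℂ (Set.range c) ∧
    Function.Injective (fun (x : X) (j : Fin n) => c j x) ∧
    ∃ S : Set (MvPolynomial (Fin n) ℂ),
      Set.range (fun (x : X) (j : Fin n) => c j x) = {a | ∀ q ∈ S, eval a q = 0}

/-- `Z ⊆ X` is the common zero set of a set of regular functions. -/
def IsZariskiClosed {X : Type*} (A : Subalgebra ℂ (X → ℂ)) (Z : Set X) : Prop :=
  ∃ S : Set (X → ℂ), S ⊆ A ∧ Z = {x | ∀ φ ∈ S, φ x = 0}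

/-- A filtration `step 0, step 1, …` of `G`, with an algebra `reg i` of functions on each step.
The axioms of an ind-variety are in `IsIndVariety`. -/
structure IndData (G : Type*) where
  step : ℕ → Set G
  reg : ∀ i, Subalgebra ℂ (step i → ℂ)

/-- The filtration consists of affine varieties, each one a closed subvariety of the next,
and it exhausts `G`. -/
structure IsIndVariety {G : Type*} (V : IndData G) : Prop where
  mono : ∀ i, V.step i ⊆ V.step (i + 1)
  exhaust : ∀ g : G, ∃ i, g ∈ V.step i
  affine : ∀ i, IsAffineVariety (V.reg i)
  closed : ∀ i, IsZariskiClosed (V.reg (i + 1)) {x : V.step (i + 1) | (x : G) ∈ V.step i}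
  restrict : ∀ i, V.reg i = (V.reg (i + 1)).map (pullback (Set.inclusion (mono i)))

/-- A morphism of ind-varieties: each step is mapped into some step, by a morphism of
varieties (i.e. regular functions pull back to regular functions). -/
def IsMorphism {G H : Type*} (V : IndData G) (W : IndData H) (f : G → H) : Prop :=
  ∀ i, ∃ j, ∃ h : Set.MapsTo f (V.step i) (W.step j),
    ∀ φ ∈ W.reg j, pullback h.restrict φ ∈ V.reg i

/-- The product of ind-varieties, filtered by `step i × step i`; the regular functions on
a product of two affine varieties are generated by those on the factors. -/
def IndData.prod {G H : Type*} (V : IndData G) (W : IndData H) : IndData (G × H) where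
  step i := V.step i ×ˢ W.step i
  reg i :=
    (V.reg i).map (pullback fun x : ↥(V.step i ×ˢ W.step i) => (⟨x.1.1, x.2.1⟩ : V.step i)) ⊔
    (W.reg i).map (pullback fun x : ↥(V.step i ×ˢ W.step i) => (⟨x.1.2, x.2.2⟩ : W.step i))

/-- A subset is closed if its intersection with each step is Zariski closed in that step. -/
def IndData.IsClosed {G : Type*} (V : IndData G) (Z : Set G) : Prop :=
  ∀ i, IsZariskiClosed (V.reg i) {x : V.step i | (x : G) ∈ Z}

/-- The structure induced along a map `f`. It is used for inclusions of subgroups (the induced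
structure of a subgroup: intersect with each step and restrict the regular functions) and for
bijections (transport of structure). -/
def IndData.comap {G H : Type*} (V : IndData G) (f : H → G) : IndData H where
  step i := f ⁻¹' V.step i
  reg i := (V.reg i).map (pullback ((Set.mapsTo_preimage f (V.step i)).restrict))

/-- `G` with the given filtration is an ind-group. -/
structure IsIndGroup {G : Type*} [Group G] (V : IndData G) : Prop where
  indVariety : IsIndVariety V
  morphism : IsMorphism (V.prod V) V (fun x => x.1 * x.2⁻¹)

/-- An isomorphism of ind-groups. -/
def IsIndGroupIso {G H : Type*} [Group G] [Group H] (V : IndData G) (W : IndData H)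
    (e : G ≃* H) : Prop :=
  IsMorphism V W e ∧ IsMorphism W V e.symm

/-- `1 → K → G → Q → 1` is a split short exact sequence of ind-groups: `ι` is an isomorphism of
ind-groups onto a closed subgroup of `G`, namely the kernel of `p`; `p` is a surjective
homomorphism of ind-groups; and `p` has a section that is a homomorphism of ind-groups. -/
structure IsSplitShortExact {K G Q : Type*} [Group K] [Group G] [Group Q]
    (VK : IndData K) (VG : IndData G) (VQ : IndData Q) (ι : K →* G) (p : G →* Q) : Prop where
  indGroup_left : IsIndGroup VK
  indGroup_mid : IsIndGroup VG
  indGroup_right : IsIndGroup VQ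
  injective : Function.Injective ι
  morphism_left : IsMorphism VK VG ι
  closed_range : VG.IsClosed (ι.range : Set G)
  iso_range : IsIndGroupIso VK (VG.comap ι.range.subtype) (MonoidHom.ofInjective injective)
  exact : ι.range = p.ker
  morphism_right : IsMorphism VG VQ p
  surjective : Function.Surjective p
  split : ∃ s : Q →* G, IsMorphism VQ VG s ∧ p.comp s = MonoidHom.id Q

/-! ### Automorphism groups of affine schemes -/

/-- The group of automorphisms of the affine scheme `Spec R` over `ℂ`. The automorphism `g`
is given by its comorphism `g* = g.unop : R → R`; as `(g ∘ h)* = h* ∘ g*`, this is the opposite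
of the group of algebra automorphisms of `R`. -/
abbrev AutSpec (R : Type*) [CommRing R] [Algebra ℂ R] : Type _ := (R ≃ₐ[ℂ] R)ᵐᵒᵖ

/-- The coordinate ring of affine `n`-space. -/
abbrev PolyRing (n : ℕ) : Type := MvPolynomial (Fin n) ℂ

/-- `Aut(𝔸ⁿ)`. -/
abbrev AutA (n : ℕ) : Type := AutSpec (PolyRing n)

/-- The filtration of `Aut(𝔸ⁿ)` by degree. The variety structure on the set of `g` of degree at
most `i` is that of the set of pairs `(g, g⁻¹)`, Zariski closed in the space of pairs of
polynomial endomorphisms (the degree of `g⁻¹` is bounded on it): the regular functions are the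
polynomials in the coefficients of the components of `g` and of `g⁻¹`. -/
def indAutA (n : ℕ) : IndData (AutA n) where
  step i := {g | ∀ j, (g.unop (X j)).totalDegree ≤ i}
  reg _ := Algebra.adjoin ℂ
    ((Set.range fun (q : Fin n × (Fin n →₀ ℕ)) => fun g =>
        coeff q.2 ((g : AutA n).unop (X q.1))) ∪
     (Set.range fun (q : Fin n × (Fin n →₀ ℕ)) => fun g =>
        coeff q.2 ((g : AutA n)⁻¹.unop (X q.1))))

/-- The structure on `Aut(Spec R)` when coordinates identify `Spec R` with `𝔸²`. -/
def indAutPlane {R : Type*} [CommRing R] [Algebra ℂ R] (v : PolyRing 2 ≃ₐ[ℂ] R) :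
    IndData (AutSpec R) :=
  (indAutA 2).comap (MulEquiv.op (AlgEquiv.autCongr v)).symm

/-- `Aut(Spec R, Γ)` for the closed subscheme `Γ = V(I)`: the automorphisms `g` such that the
scheme-theoretic image `g(Γ) = V((g*)⁻¹ I)` is `Γ`. -/
def autPreserving {R : Type*} [CommRing R] [Algebra ℂ R] (I : Ideal R) :
    Subgroup (AutSpec R) where
  carrier := {g | I.comap (g.unop : R →+* R) = I}
  one_mem' := by
    ext x
    simp [Ideal.mem_comap]
  mul_mem' := by
    intro g h hg hh
    ext x
    have hg' := fun x => Ideal.ext_iff.1 hg x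
    have hh' := fun x => Ideal.ext_iff.1 hh x
    simp only [Ideal.mem_comap, RingHom.coe_coe] at hg' hh' ⊢
    rw [MulOpposite.unop_mul, AlgEquiv.mul_apply, hh', hg']
  inv_mem' := by
    intro g hg
    ext x
    have hg' := fun x => Ideal.ext_iff.1 hg x
    simp only [Ideal.mem_comap, RingHom.coe_coe] at hg' ⊢
    rw [← hg', MulOpposite.unop_inv, ← AlgEquiv.mul_apply, mul_inv_cancel, AlgEquiv.one_apply]

/-! ### Unipotent automorphisms and their modifications -/

/-- Derivations of the coordinate ring of `𝔸ⁿ`. -/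
abbrev Der (n : ℕ) : Type := Derivation ℂ (PolyRing n) (PolyRing n)

/-- `D` is locally nilpotent. -/
def IsLocallyNilpotent {n : ℕ} (D : Der n) : Prop :=
  ∀ f, ∃ k : ℕ, D^[k] f = 0

/-- `u = Exp(D)`, i.e. `u* = ∑ Dⁱ / i!` (used for locally nilpotent `D`, where the sum is
finite on every polynomial). -/
def IsExp {n : ℕ} (D : Der n) (u : AutA n) : Prop :=
  ∀ f, u.unop f = ∑ᶠ i : ℕ, ((i.factorial : ℂ)⁻¹) • D^[i] f

/-- `u` is unipotent. -/
def IsUnipotent {n : ℕ} (u : AutA n) : Prop :=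
  ∃ D : Der n, IsLocallyNilpotent D ∧ IsExp D u

/-- `g = f · u`: one has `u = Exp(D)`, `f ∈ ker D` and `g = Exp(f D)`. -/
def IsModification {n : ℕ} (f : PolyRing n) (u g : AutA n) : Prop :=
  ∃ D : Der n, IsLocallyNilpotent D ∧ IsExp D u ∧ D f = 0 ∧ IsExp (f • D) g

/-- `u` is an irreducible unipotent automorphism. -/
def IsIrreducible {n : ℕ} (u : AutA n) : Prop :=
  IsUnipotent u ∧ u ≠ 1 ∧
    ∀ (f : PolyRing n) (u' : AutA n), IsModification f u' u → ∃ c : ℂ, c ≠ 0 ∧ f = C c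

/-- `u = d · u'` is a standard decomposition. -/
def IsStandardDecomposition {n : ℕ} (u : AutA n) (d : PolyRing n) (u' : AutA n) : Prop :=
  IsIrreducible u' ∧ IsModification d u' u

/-- `t` is a translation: `t(x, y, z) = (x + 1, y, z)` for some coordinates `x, y, z`
of `𝔸³`. -/
def IsTranslation (t : AutA 3) : Prop :=
  ∃ c : PolyRing 3 ≃ₐ[ℂ] PolyRing 3,
    t.unop (c (X 0)) = c (X 0) + 1 ∧ t.unop (c (X 1)) = c (X 1) ∧ t.unop (c (X 2)) = c (X 2)

/-- `u` is a modification of a translation. -/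
def IsModifiedTranslation (u : AutA 3) : Prop :=
  ∃ (f : PolyRing 3) (t : AutA 3), IsTranslation t ∧ IsModification f t u

/-! ### The algebraic quotient, the plinth divisor and the centralizer -/

/-- The ring of `u`-invariant polynomials; `Spec` of it is the algebraic quotient. -/
def invariants {n : ℕ} (u : AutA n) : Subalgebra ℂ (PolyRing n) :=
  AlgHom.equalizer (u.unop : PolyRing n →ₐ[ℂ] PolyRing n) (AlgHom.id ℂ (PolyRing n))

theorem mem_invariants {n : ℕ} {u : AutA n} {f : PolyRing n} :
    f ∈ invariants u ↔ u.unop f = f := Iff.rfl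

theorem mem_invariants_iff {n : ℕ} {u : AutA n} {D : Der n} (hD : IsLocallyNilpotent D)
    (hu : IsExp D u) (f : PolyRing n) : f ∈ invariants u ↔ D f = 0 := by
  have hL : ∀ i g, D^[i] g = ((D : PolyRing n →ₗ[ℂ] PolyRing n) ^ i) g := fun i g => by
    rw [Module.End.pow_apply]; rfl
  rw [mem_invariants, hu f]
  have hz : ∀ m i, D^[m] f = 0 → m ≤ i → D^[i] f = 0 := by
    intro m i hm hi
    obtain ⟨j, rfl⟩ := Nat.exists_eq_add_of_le' hi
    rw [Function.iterate_add_apply, hm, hL, map_zero]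
  have hsum : ∀ m, D^[m] f = 0 → ∑ᶠ i : ℕ, ((i.factorial : ℂ)⁻¹) • D^[i] f =
      ∑ i ∈ Finset.range m, ((i.factorial : ℂ)⁻¹) • D^[i] f := by
    intro m hm
    refine finsum_eq_sum_of_support_subset _ fun i hi => ?_
    by_contra h
    refine hi ?_
    simp only [Finset.coe_range, Set.mem_Iio, not_lt] at h
    simp only [hz m i hm h, smul_zero]
  constructor
  · intro h
    by_contra hne
    have hex := hD f
    have hk := Nat.find_spec hex
    have hmin : ∀ m < Nat.find hex, ¬ D^[m] f = 0 := fun m hm => Nat.find_min hex hm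
    generalize Nat.find hex = k at hk hmin
    match k, hk, hmin with
    | 0, hk, _ => exact hne (hz 0 1 hk (by omega))
    | 1, hk, _ => exact hne hk
    | m + 2, hk, hmin =>
      rw [hsum _ hk, Finset.sum_range_succ'] at h
      simp only [Nat.factorial_zero, Nat.cast_one, inv_one, one_smul, Function.iterate_zero,
        id_eq, add_eq_right] at h
      have h2 := congrArg (fun g => D^[m] g) h
      simp only [hL m, map_sum, map_smul, map_zero] at h2
      rw [Finset.sum_range_succ', Finset.sum_eq_zero] at h2
      · refine hmin (m + 1) (by omega) ?_
        simp only [Nat.factorial_one, Nat.cast_one, inv_one, one_smul,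
          zero_add] at h2
        rw [← hL, ← Function.iterate_add_apply] at h2
        exact h2
      · intro i _
        rw [← hL, ← Function.iterate_add_apply, hz (m + 2) _ hk (by omega), smul_zero]
  · intro h
    rw [hsum 1 h]
    simp

/-- The plinth ideal `im D ∩ ker D` of `ker D`, for `u = Exp(D)`. By `mem_invariants_iff`,
`ker D` is the ring of invariants of `u`. The plinth divisor `Γ` of `u` is the closed subscheme
of the algebraic quotient defined by this ideal. -/
def plinthIdeal {n : ℕ} {u : AutA n} {D : Der n} (hD : IsLocallyNilpotent D)
    (hu : IsExp D u) : Ideal (invariants u) where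
  carrier := {a | ∃ f, D f = (a : PolyRing n)}
  zero_mem' := ⟨0, by simp⟩
  add_mem' := by
    rintro a b ⟨f, hf⟩ ⟨g, hg⟩
    exact ⟨f + g, by simp [hf, hg]⟩
  smul_mem' := by
    rintro b a ⟨f, hf⟩
    have hb : D (b : PolyRing n) = 0 := (mem_invariants_iff hD hu _).1 b.2
    exact ⟨b * f, by simp [hf, hb]⟩

/-- `Cent(u)`. -/
abbrev Cent {n : ℕ} (u : AutA n) : Subgroup (AutA n) := Subgroup.centralizer {u}

theorem Cent.map_invariants {n : ℕ} {u : AutA n} (g : Cent u) {f : PolyRing n}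
    (hf : f ∈ invariants u) : (g : AutA n).unop f ∈ invariants u := by
  have h := Subgroup.mem_centralizer_singleton_iff.1 g.2
  have h2 := congrArg (fun k : AutA n => k.unop f) h
  simp only [MulOpposite.unop_mul, AlgEquiv.mul_apply] at h2
  rw [mem_invariants] at hf ⊢
  rw [hf] at h2
  exact h2

/-- The induced action of `Cent(u)` on the algebraic quotient: the comorphism of `quotientHom u g`
is the restriction of `g*` to the invariants. -/
def quotientHom {n : ℕ} (u : AutA n) : Cent u →* AutSpec (invariants u) where
  toFun g := MulOpposite.op
    { toFun := fun f => ⟨(g : AutA n).unop f, Cent.map_invariants g f.2⟩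
      invFun := fun f => ⟨((g⁻¹ : Cent u) : AutA n).unop f, Cent.map_invariants g⁻¹ f.2⟩
      left_inv := fun f => Subtype.ext (by simp [AlgEquiv.aut_inv])
      right_inv := fun f => Subtype.ext (by simp [AlgEquiv.aut_inv])
      map_mul' := fun f f' => Subtype.ext (by simp)
      map_add' := fun f f' => Subtype.ext (by simp)
      commutes' := fun c => Subtype.ext ((g : AutA n).unop.commutes c) }
  map_one' := rfl
  map_mul' _ _ := rfl

theorem quotientHom_apply {n : ℕ} (u : AutA n) (g : Cent u) (f : invariants u) :
    (((quotientHom u g).unop f : invariants u) : PolyRing n) = (g : AutA n).unop f := rfl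

end IndAut

end

open IndAut

/-!
Let `t` be a translation of which `u` is a modification, `t = Exp(D₀)`. In suitable coordinates
`D₀` is `∂/∂X₀` (`exists_isStraightening`), `ker D₀` is the polynomial ring in the other two
coordinates, and `D = f D₀` with `0 ≠ f ∈ ker D₀`, because a unipotent automorphism determines its
locally nilpotent derivation: `D g` is the linear coefficient of the polynomial `k ↦ Exp(D)ᵏ g`
(`IsExp.derivation_unique`). Since `D₀` maps the slice `X₀` to `1`, the plinth ideal is `(f)`, and
by irreducibility the derivation of `u'` is a constant multiple of `D₀`
(`exists_const_of_isIrreducible`). So `u` is a translation iff `f` is constant.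

An automorphism `g` centralizes `u` iff `g*` commutes with `f D₀`. Evaluating on the slice gives
`g* f = f · D₀(g* X₀)`, and the same for `g⁻¹` makes `D₀(g* X₀)` a unit, hence a constant `z`
(`Cent.exists_const`). Thus `g` preserves `(f)`; and if `g` is trivial on `ker D₀`, then `z = 1` and
`g* X₀ = X₀ + h` with `h ∈ ker D₀`, that is, `g = Exp(h D₀)` (`quotientHom_eq_one_iff`). Conversely
an automorphism `φ` of the plane preserving `(f)` satisfies `φ* f = z f` for a constant `z`, and
multiplying `X₀` by `z` while acting by `φ` on the other coordinates is a lift of `φ` to the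
centralizer, multiplicative in `φ` (`split_of_straightening`).

The ind-group structures rest on two facts. The degree of `g⁻¹` is bounded in terms of that of `g`
(`exists_totalDegree_inv_le`), so only finitely many coefficients matter and each step of the
filtration of `Aut(𝔸ⁿ)` is an affine variety. Families of polynomials of bounded degree with regular
coefficients form an algebra closed under substitution (`aeval_mem_regularFamilies`); this makes all
the maps above morphisms, and all the subgroups involved are closed as loci where two morphisms to
some `Aut(𝔸ⁿ)` agree, or where two regular families do.
-/

noncomputable section

namespace IndAut

/-! ### Closed subgroups and morphisms of ind-groups -/

section Generic

variable {X G H K : Type*}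

/-- A criterion for affineness with generators indexed by any finite type: the set of defining
equations is taken to be the full ideal of the image. -/
theorem isAffineVariety_of_fintype {ι : Type*} [Fintype ι] {A : Subalgebra ℂ (X → ℂ)}
    (c : ι → X → ℂ) (hA : A = Algebra.adjoin ℂ (Set.range c))
    (hinj : Function.Injective fun x j => c j x)
    (hz : ∀ a : ι → ℂ, (∀ q : MvPolynomial ι ℂ, (∀ x, eval (fun j => c j x) q = 0) →
      eval a q = 0) → ∃ x, (fun j => c j x) = a) : IsAffineVariety A := by
  let e := Fintype.equivFin ι
  refine ⟨Fintype.card ι, fun j => c (e.symm j), ?_, ?_,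
    {q | ∀ x, eval (fun j => c (e.symm j) x) q = 0}, ?_⟩
  · rw [hA]
    congr 1
    exact (e.symm.surjective.range_comp c).symm
  · intro x y h
    apply hinj
    funext j
    simpa using congrFun h (e j)
  · ext a
    constructor
    · rintro ⟨x, rfl⟩ q hq
      exact hq x
    · intro h
      obtain ⟨x, hx⟩ := hz (a ∘ e) (fun q hq => by
        have := h (rename e q) (fun x => by
          rw [eval_rename]
          simpa [Function.comp_def] using hq x)
        rwa [eval_rename] at this)
      exact ⟨x, by funext j; simpa using congrFun hx (e.symm j)⟩

theorem IsMorphism.comp {U : IndData G} {V : IndData H} {W : IndData K} {g : H → K} {f : G → H}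
    (hg : IsMorphism V W g) (hf : IsMorphism U V f) : IsMorphism U W (g ∘ f) := by
  intro i
  obtain ⟨j, hj, hj'⟩ := hf i
  obtain ⟨k, hk, hk'⟩ := hg j
  exact ⟨k, hk.comp hj, fun φ hφ => hj' _ (hk' φ hφ)⟩

theorem IsMorphism.id (V : IndData G) : IsMorphism V V (fun x => x) :=
  fun i => ⟨i, fun _ h => h, fun _ h => h⟩

theorem isMorphism_comap (V : IndData G) (f : H → G) : IsMorphism (V.comap f) V f :=
  fun i => ⟨i, fun _ h => h, fun φ hφ => ⟨φ, hφ, rfl⟩⟩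

/-- Morphisms into an induced structure are detected on the ambient ind-variety. -/
theorem isMorphism_comap_iff {U : IndData K} {V : IndData G} {f : H → G} {h : K → H} :
    IsMorphism U (V.comap f) h ↔ IsMorphism U V (f ∘ h) := by
  refine ⟨fun hh => (isMorphism_comap V f).comp hh, fun hh i => ?_⟩
  obtain ⟨j, hj, hj'⟩ := hh i
  refine ⟨j, fun x hx => hj hx, ?_⟩
  rintro φ ⟨ψ, hψ, rfl⟩
  exact hj' ψ hψ

/-- A closed subset of an ind-variety, with the induced structure, is an ind-variety. -/
theorem IsIndVariety.comap {V : IndData G} (hV : IsIndVariety V) {f : H → G}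
    (hf : Function.Injective f) (hc : V.IsClosed (Set.range f)) : IsIndVariety (V.comap f) where
  mono i := Set.preimage_mono (hV.mono i)
  exhaust h := hV.exhaust (f h)
  affine i := by
    obtain ⟨n, c, hA, hinj, S, hS⟩ := hV.affine i
    let ρ : (V.comap f).step i → V.step i := (Set.mapsTo_preimage f (V.step i)).restrict
    refine isAffineVariety_of_fintype (fun j => c j ∘ ρ) ?_ ?_ ?_
    · change (V.reg i).map (pullback ρ) = _
      rw [hA, AlgHom.map_adjoin, ← Set.range_comp]
      rfl
    · intro x y h
      have := hinj (a₁ := ρ x) (a₂ := ρ y) h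
      exact Subtype.ext (hf (congrArg Subtype.val this))
    · intro a ha
      -- the equations of the ambient variety hold at `a`, so `a` comes from a point `x` of it
      have h1 : a ∈ Set.range (fun (x : V.step i) (j : Fin n) => c j x) := by
        rw [hS]
        intro q hq
        refine ha q fun x => ?_
        have : (fun j => c j (ρ x)) ∈ Set.range (fun (x : V.step i) (j : Fin n) => c j x) :=
          ⟨ρ x, rfl⟩
        rw [hS] at this
        exact this q hq
      obtain ⟨x, rfl⟩ := h1
      obtain ⟨T, hT, hTZ⟩ := hc i
      have hx : x ∈ {x : V.step i | (x : G) ∈ Set.range f} := by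
        rw [hTZ]
        intro φ hφ
        have hφA := hT hφ
        rw [hA, Algebra.adjoin_range_eq_range_aeval] at hφA
        obtain ⟨q, rfl⟩ := hφA
        have hq : ∀ y, aeval c q y = eval (fun j => c j y) q := fun y => by
          have := comp_aeval_apply c (Pi.evalAlgHom ℂ (fun _ : V.step i => ℂ) y) q
          simpa [aeval_eq_eval] using this
        have h2 := ha q fun y => by
          have hy : ρ y ∈ {x : V.step i | (x : G) ∈ Set.range f} := ⟨y.1, rfl⟩
          rw [hTZ] at hy
          have := hy _ hφ
          exact (hq _).symm.trans this
        exact (hq x).trans h2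
      obtain ⟨y, hy⟩ := hx
      refine ⟨⟨y, ?_⟩, ?_⟩
      · change f y ∈ V.step i
        rw [hy]
        exact x.2
      · funext j
        exact congrArg (c j) (Subtype.ext hy)
  closed i := by
    obtain ⟨S, hS, hSZ⟩ := hV.closed i
    refine ⟨(pullback ((Set.mapsTo_preimage f (V.step (i + 1))).restrict)) '' S, ?_, ?_⟩
    · rintro _ ⟨φ, hφ, rfl⟩
      exact ⟨φ, hS hφ, rfl⟩
    · ext x
      have := Set.ext_iff.1 hSZ ⟨f x, x.2⟩
      exact this.trans
        ⟨by rintro h _ ⟨ψ, hψ, rfl⟩; exact h ψ hψ, fun h ψ hψ => h _ ⟨ψ, hψ, rfl⟩⟩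
  restrict i := by
    change (V.reg i).map _ = _
    rw [hV.restrict i, Subalgebra.map_map]
    exact (Subalgebra.map_map (V.reg (i + 1))
      (pullback (Set.inclusion (Set.preimage_mono (f := f) (hV.mono i))))
      (pullback ((Set.mapsTo_preimage f (V.step (i + 1))).restrict))).symm

theorem IsMorphism.prodMap_comap (V : IndData G) (f : H → G) :
    IsMorphism ((V.comap f).prod (V.comap f)) (V.prod V) (Prod.map f f) := by
  intro i
  refine ⟨i, fun x hx => hx, fun φ hφ => ?_⟩
  refine (?_ : (V.prod V).reg i ≤ (((V.comap f).prod (V.comap f)).reg i).comap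
    (pullback (Set.MapsTo.restrict (Prod.map f f) (((V.comap f).prod (V.comap f)).step i)
      ((V.prod V).step i) fun _ hx => hx))) hφ
  refine sup_le ?_ ?_
  · rintro _ ⟨ψ, hψ, rfl⟩
    exact Algebra.mem_sup_left ⟨_, ⟨ψ, hψ, rfl⟩, rfl⟩
  · rintro _ ⟨ψ, hψ, rfl⟩
    exact Algebra.mem_sup_right ⟨_, ⟨ψ, hψ, rfl⟩, rfl⟩

/-- A closed subgroup of an ind-group, with the induced structure, is an ind-group. -/
theorem IsIndGroup.comap [Group G] [Group H] {V : IndData G} (hV : IsIndGroup V) {f : H →* G}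
    (hf : Function.Injective f) (hc : V.IsClosed (Set.range f)) : IsIndGroup (V.comap f) where
  indVariety := hV.indVariety.comap hf hc
  morphism := by
    rw [isMorphism_comap_iff]
    convert hV.morphism.comp (IsMorphism.prodMap_comap V f) using 1
    funext x
    simp

/-! ### Regular families of polynomials -/

/-- Families of polynomials of bounded degree, all of whose coefficients are regular functions
of the parameter. -/
def regularFamilies (A : Subalgebra ℂ (X → ℂ)) (σ : Type*) :
    Subalgebra ℂ (X → MvPolynomial σ ℂ) where
  carrier := {P | (∀ m, (fun x => coeff m (P x)) ∈ A) ∧ ∃ N, ∀ x, (P x).totalDegree ≤ N}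
  mul_mem' := by
    classical
    rintro P Q ⟨hP, M, hM⟩ ⟨hQ, N, hN⟩
    refine ⟨fun m => ?_, M + N, fun x => (totalDegree_mul _ _).trans (add_le_add (hM x) (hN x))⟩
    have : (fun x => coeff m ((P * Q) x)) = ∑ p ∈ Finset.HasAntidiagonal.antidiagonal m,
        (fun x => coeff p.1 (P x)) * (fun x => coeff p.2 (Q x)) := by
      funext x
      simp [coeff_mul]
    rw [this]
    exact A.sum_mem fun p _ => A.mul_mem (hP _) (hQ _)
  add_mem' := by
    rintro P Q ⟨hP, M, hM⟩ ⟨hQ, N, hN⟩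
    refine ⟨fun m => ?_, max M N, fun x => (totalDegree_add _ _).trans (max_le_max (hM x) (hN x))⟩
    have : (fun x => coeff m ((P + Q) x)) = (fun x => coeff m (P x)) + fun x => coeff m (Q x) := by
      funext x
      simp
    rw [this]
    exact A.add_mem (hP _) (hQ _)
  algebraMap_mem' r := by
    classical
    refine ⟨fun m => ?_, 0, fun x => by simp [algebraMap_eq]⟩
    have : (fun x => coeff m (algebraMap ℂ (X → MvPolynomial σ ℂ) r x)) =
        algebraMap ℂ (X → ℂ) (coeff m (C r : MvPolynomial σ ℂ)) := by
      funext x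
      simp [algebraMap_eq]
    rw [this]
    exact A.algebraMap_mem _

theorem const_mem_regularFamilies (A : Subalgebra ℂ (X → ℂ)) {σ : Type*} (p : MvPolynomial σ ℂ) :
    (fun _ => p) ∈ regularFamilies A σ :=
  ⟨fun m => A.algebraMap_mem (coeff m p), p.totalDegree, fun _ => le_rfl⟩

theorem C_mem_regularFamilies {A : Subalgebra ℂ (X → ℂ)} {σ : Type*} {φ : X → ℂ} (hφ : φ ∈ A) :
    (fun x => C (φ x)) ∈ regularFamilies A σ := by
  classical
  refine ⟨fun m => ?_, 0, fun x => by simp⟩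
  simp only [coeff_C]
  split_ifs
  · exact hφ
  · exact A.zero_mem

/-- Substituting regular families into a regular family gives a regular family. -/
theorem aeval_mem_regularFamilies {A : Subalgebra ℂ (X → ℂ)} {σ τ : Type*} [Fintype σ]
    {P : X → MvPolynomial σ ℂ} (hP : P ∈ regularFamilies A σ) {Q : σ → X → MvPolynomial τ ℂ}
    (hQ : ∀ j, Q j ∈ regularFamilies A τ) :
    (fun x => aeval (fun j => Q j x) (P x)) ∈ regularFamilies A τ := by
  obtain ⟨hP, N, hN⟩ := hP
  let s := (Finsupp.finite_of_degree_le (σ := σ) N).toFinset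
  have : (fun x => aeval (fun j => Q j x) (P x)) =
      ∑ m ∈ s, (fun x => (C (coeff m (P x)) : MvPolynomial τ ℂ)) * ∏ j, Q j ^ m j := by
    funext x
    rw [aeval_def, eval₂_eq']
    simp only [Finset.sum_apply, Pi.mul_apply, Finset.prod_apply, Pi.pow_apply, algebraMap_eq]
    refine Finset.sum_subset ?_ ?_
    · intro m hm
      simp only [s, Set.Finite.mem_toFinset, Set.mem_ofPred_eq]
      exact (le_totalDegree hm).trans (hN x)
    · intro m _ hm
      rw [notMem_support_iff.1 hm]
      simp
  rw [this]
  exact Subalgebra.sum_mem _ fun m _ => Subalgebra.mul_mem _ (C_mem_regularFamilies (hP m))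
    (Subalgebra.prod_mem _ fun j _ => Subalgebra.pow_mem _ (hQ j) _)

/-- A family of polynomials parametrized by an ind-variety is regular if it is so on each step. -/
def IndData.RegularFamily (V : IndData G) {σ : Type*} (P : G → MvPolynomial σ ℂ) : Prop :=
  ∀ i, (fun x : V.step i => P x) ∈ regularFamilies (V.reg i) σ

namespace IndData.RegularFamily

variable {V : IndData G} {σ τ : Type*}

theorem const (p : MvPolynomial σ ℂ) : V.RegularFamily (fun _ => p) :=
  fun _ => const_mem_regularFamilies _ p

theorem mul {P Q : G → MvPolynomial σ ℂ} (hP : V.RegularFamily P) (hQ : V.RegularFamily Q) :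
    V.RegularFamily (fun x => P x * Q x) :=
  fun i => Subalgebra.mul_mem _ (hP i) (hQ i)

theorem C_coeff {P : G → MvPolynomial σ ℂ} (hP : V.RegularFamily P) (m : σ →₀ ℕ) :
    V.RegularFamily (fun x => (C (coeff m (P x)) : MvPolynomial τ ℂ)) :=
  fun i => C_mem_regularFamilies ((hP i).1 m)

theorem aeval [Fintype σ] {P : G → MvPolynomial σ ℂ} (hP : V.RegularFamily P)
    {Q : σ → G → MvPolynomial τ ℂ} (hQ : ∀ j, V.RegularFamily (Q j)) :
    V.RegularFamily (fun x => MvPolynomial.aeval (fun j => Q j x) (P x)) :=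
  fun i => aeval_mem_regularFamilies (hP i) fun j => hQ j i

theorem algHom [Fintype σ] {P : G → MvPolynomial σ ℂ} (hP : V.RegularFamily P)
    (r : MvPolynomial σ ℂ →ₐ[ℂ] MvPolynomial τ ℂ) : V.RegularFamily (fun x => r (P x)) := by
  have := hP.aeval (Q := fun j _ => r (X j)) fun j => const _
  convert this using 2 with x
  exact DFunLike.congr_fun (MvPolynomial.aeval_unique r) _

theorem comp {W : IndData H} {P : H → MvPolynomial σ ℂ} (hP : W.RegularFamily P) {f : G → H}
    (hf : IsMorphism V W f) : V.RegularFamily (fun x => P (f x)) := by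
  intro i
  obtain ⟨j, hj, hj'⟩ := hf i
  obtain ⟨h1, N, hN⟩ := hP j
  exact ⟨fun m => hj' _ (h1 m), N, fun x => hN ⟨f x, hj x.2⟩⟩

theorem isClosed_eq {P Q : G → MvPolynomial σ ℂ} (hP : V.RegularFamily P)
    (hQ : V.RegularFamily Q) : V.IsClosed {x | P x = Q x} := by
  intro i
  refine ⟨Set.range fun m => (fun x : V.step i => coeff m (P x)) -
    fun x : V.step i => coeff m (Q x), ?_, ?_⟩
  · rintro _ ⟨m, rfl⟩
    exact Subalgebra.sub_mem _ ((hP i).1 m) ((hQ i).1 m)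
  · ext x
    simp [MvPolynomial.ext_iff, sub_eq_zero]

end IndData.RegularFamily

theorem IndData.IsClosed.iInter {V : IndData G} {ι : Type*} {Z : ι → Set G}
    (hZ : ∀ k, V.IsClosed (Z k)) : V.IsClosed (⋂ k, Z k) := by
  intro i
  choose S hS hSZ using fun k => hZ k i
  refine ⟨⋃ k, S k, Set.iUnion_subset hS, ?_⟩
  ext x
  have := fun k => Set.ext_iff.1 (hSZ k) x
  simp only [Set.mem_ofPred_eq] at this
  simp only [Set.mem_ofPred_eq, Set.mem_iInter, Set.mem_iUnion, this]
  exact ⟨fun h φ ⟨k, hk⟩ => h k φ hk, fun h k φ hk => h φ ⟨k, hk⟩⟩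

end Generic

/-! ### The degree of an inverse automorphism -/

/-- A root of a non-zero polynomial divides one of its non-zero coefficients. -/
theorem exists_dvd_coeff_of_eval_eq_zero {R : Type*} [CommRing R] [IsDomain R] {p : Polynomial R}
    (hp : p ≠ 0) {a : R} (ha : a ≠ 0) (h : p.eval a = 0) : ∃ k, p.coeff k ≠ 0 ∧ a ∣ p.coeff k := by
  obtain ⟨q, hq⟩ : Polynomial.X ^ p.natTrailingDegree ∣ p :=
    Polynomial.X_pow_dvd_iff.2 fun _ => Polynomial.coeff_eq_zero_of_lt_natTrailingDegree
  refine ⟨p.natTrailingDegree, by simpa using hp, ?_⟩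
  have hc : p.coeff p.natTrailingDegree = q.coeff 0 := by
    have := Polynomial.coeff_X_pow_mul q p.natTrailingDegree 0
    rwa [← hq, zero_add] at this
  have hq0 : q.eval a = 0 := by
    rw [hq, Polynomial.eval_mul, Polynomial.eval_pow, Polynomial.eval_X] at h
    exact (mul_eq_zero.1 h).resolve_left (pow_ne_zero _ ha)
  rw [hc, ← dvd_neg]
  refine ⟨q.divX.eval a, ?_⟩
  rw [← Polynomial.divX_mul_X_add q] at hq0
  simp only [Polynomial.eval_add, Polynomial.eval_mul, Polynomial.eval_X, Polynomial.eval_C] at hq0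
  linear_combination -hq0

/-- If the components of `g` have degree at most `d`, those of `g⁻¹` have a degree bounded in
terms of `n` and `d`. For large `N`, a dimension count gives a relation
`∑ₖ Pₖ(g* X₁, …, g* Xₙ) Xⱼᵏ = 0` with `k` and all exponents in the `Pₖ` at most `N`. Applying
`(g⁻¹)*` makes `(g⁻¹)* Xⱼ` a root of `∑ₖ Pₖ Tᵏ`, hence a divisor of a non-zero `Pₖ`. -/
theorem exists_totalDegree_inv_le (n d : ℕ) : ∃ B, ∀ g : AutA n,
    (∀ j, (g.unop (X j)).totalDegree ≤ d) → ∀ j, (g⁻¹.unop (X j)).totalDegree ≤ B := by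
  -- `M` bounds the degrees of the products of powers of the `g* Xᵢ` and of `Xⱼ` with exponents at
  -- most `N`, and `N` is so large that these outnumber the monomials with exponents at most `M`
  set e := (n + 1) * (d + 1) with he
  set N := e ^ n with hN
  set M := N * e with hM
  have he1 : 1 ≤ e := Nat.succ_le_of_lt (by positivity)
  have hcount : (M + 1) ^ n < (N + 1) ^ (n + 1) := by
    calc (M + 1) ^ n ≤ ((N + 1) * e) ^ n := by gcongr; rw [hM, add_mul]; omega
      _ = (N + 1) ^ n * N := by rw [mul_pow]
      _ < (N + 1) ^ n * (N + 1) := by gcongr; omega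
      _ = _ := by rw [pow_succ]
  refine ⟨n * N, fun g hg j => ?_⟩
  set G := g⁻¹.unop (X j) with hGdef
  by_cases hG0 : G = 0
  · simp [hG0]
  have hgG : g.unop G = X j := by
    rw [hGdef, MulOpposite.unop_inv, ← AlgEquiv.mul_apply, mul_inv_cancel, AlgEquiv.one_apply]
  let term : ((Fin n → Fin (N + 1)) × Fin (N + 1)) → PolyRing n := fun α =>
    (∏ i, X i ^ (α.1 i : ℕ)) * G ^ (α.2 : ℕ)
  let L : (((Fin n → Fin (N + 1)) × Fin (N + 1)) → ℂ) →ₗ[ℂ] ((Fin n → Fin (M + 1)) → ℂ) :=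
    LinearMap.pi fun m => (lcoeff ℂ (Finsupp.equivFunOnFinite.symm fun i => (m i : ℕ))).comp
      ((g.unop.toLinearMap).comp (Fintype.linearCombination ℂ term))
  have hker : LinearMap.ker L ≠ ⊥ := by
    apply LinearMap.ker_ne_bot_of_finrank_lt
    simpa [pow_succ] using hcount
  obtain ⟨c, hc, hc0⟩ := (Submodule.ne_bot_iff _).1 hker
  have hsum : g.unop (∑ α, c α • term α) = ∑ α, c α • g.unop (term α) := by
    simp
  have hdeg : (g.unop (∑ α, c α • term α)).totalDegree ≤ M := by
    rw [hsum]
    refine totalDegree_finsetSum_le fun α _ => (totalDegree_smul_le _ _).trans ?_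
    simp only [term, map_mul, map_prod, map_pow, hgG]
    calc _ ≤ (∏ i, g.unop (X i) ^ (α.1 i : ℕ)).totalDegree +
          (X j ^ (α.2 : ℕ) : PolyRing n).totalDegree := totalDegree_mul _ _
      _ ≤ ∑ _i : Fin n, N * d + N * 1 := by
        refine add_le_add ((totalDegree_finsetProd _ _).trans (Finset.sum_le_sum fun i _ => ?_)) ?_
        · exact (totalDegree_pow _ _).trans
            (Nat.mul_le_mul (Nat.le_of_lt_succ (α.1 i).2) (hg i))
        · refine (totalDegree_pow _ _).trans (Nat.mul_le_mul (Nat.le_of_lt_succ α.2.2) ?_)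
          simp
      _ ≤ M := by
        rw [Finset.sum_const, Finset.card_univ, Fintype.card_fin, smul_eq_mul, hM, he]
        nlinarith [Nat.zero_le (N * n), Nat.zero_le (N * d)]
  -- `L` records only the coefficients with exponents at most `M`; the others vanish by the degree
  -- bound
  have hzero : g.unop (∑ α, c α • term α) = 0 := by
    ext m
    rw [coeff_zero]
    by_cases hm : ∀ i, m i < M + 1
    · have := congrFun (LinearMap.mem_ker.1 hc) fun i => ⟨m i, hm i⟩
      simp only [L, LinearMap.pi_apply, LinearMap.comp_apply, Fintype.linearCombination_apply,
        Pi.zero_apply] at this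
      convert this using 1
      change _ = coeff _ (g.unop _)
      congr 2
      ext i
      rfl
    · push Not at hm
      obtain ⟨i, hi⟩ := hm
      refine coeff_eq_zero_of_totalDegree_lt (hdeg.trans_lt ?_)
      have := Finsupp.le_degree i m
      rw [Finsupp.degree] at this
      exact lt_of_lt_of_le (Nat.lt_of_succ_le hi) this
  have hrel : ∑ α, c α • term α = 0 := g.unop.injective (hzero.trans (map_zero _).symm)
  -- read the relation as a polynomial equation for `G` with coefficients `P k`
  let P : Fin (N + 1) → PolyRing n := fun k =>
    ∑ α : Fin n → Fin (N + 1),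
      monomial (Finsupp.equivFunOnFinite.symm fun i => (α i : ℕ)) (c (α, k))
  have hPdeg : ∀ k, (P k).totalDegree ≤ n * N := fun k => by
    refine totalDegree_finsetSum_le fun α _ => (totalDegree_monomial_le _ _).trans ?_
    rw [Finsupp.sum_fintype _ _ fun _ => rfl]
    calc _ ≤ ∑ _i : Fin n, N := Finset.sum_le_sum fun i _ => Nat.le_of_lt_succ (α i).2
      _ = n * N := by simp
  have hPcoeff : ∀ α k, coeff (Finsupp.equivFunOnFinite.symm fun i => (α i : ℕ)) (P k) =
      c (α, k) := fun α k => by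
    classical
    simp only [P, coeff_sum, coeff_monomial]
    rw [Finset.sum_eq_single α]
    · simp
    · intro β _ hβ
      rw [if_neg]
      intro h
      apply hβ
      funext i
      have := DFunLike.congr_fun h i
      exact Fin.ext this
    · simp
  let p : Polynomial (PolyRing n) := ∑ k : Fin (N + 1), Polynomial.monomial (k : ℕ) (P k)
  have hpcoeff : ∀ k : Fin (N + 1), p.coeff k = P k := fun k => by
    simp only [p, Polynomial.finsetSum_coeff, Polynomial.coeff_monomial]
    rw [Finset.sum_eq_single k]
    · simp
    · intro l _ hl
      rw [if_neg fun h => hl (Fin.ext h)]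
    · simp
  have hpdeg : ∀ k, (p.coeff k).totalDegree ≤ n * N := fun k => by
    by_cases hk : k < N + 1
    · exact (hpcoeff ⟨k, hk⟩) ▸ hPdeg _
    · simp only [p, Polynomial.finsetSum_coeff, Polynomial.coeff_monomial]
      rw [Finset.sum_eq_zero]
      · simp
      · intro l _
        rw [if_neg]
        have := l.2
        omega
  have hp0 : p ≠ 0 := fun h => by
    apply hc0
    funext ⟨α, k⟩
    rw [← hPcoeff, ← hpcoeff, h]
    simp
  have hproot : p.eval G = 0 := by
    rw [← hrel, Fintype.sum_prod_type_right]
    simp only [p, Polynomial.eval_finsetSum, Polynomial.eval_monomial, P, Finset.sum_mul]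
    refine Finset.sum_congr rfl fun k _ => Finset.sum_congr rfl fun α _ => ?_
    rw [monomial_eq, Finsupp.prod_fintype _ _ fun _ => pow_zero _]
    simp [term, smul_eq_C_mul, mul_assoc]
  obtain ⟨k, hk0, hk⟩ := exists_dvd_coeff_of_eval_eq_zero hp0 hG0 hproot
  exact (totalDegree_le_of_dvd_of_isDomain hk hk0).trans (hpdeg k)

/-! ### The ind-group of automorphisms of affine space -/

theorem unop_inv_unop {R : Type*} [CommRing R] [Algebra ℂ R] (g : AutSpec R) (p : R) :
    g⁻¹.unop (g.unop p) = p := by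
  rw [MulOpposite.unop_inv, ← AlgEquiv.mul_apply, inv_mul_cancel, AlgEquiv.one_apply]

theorem unop_unop_inv {R : Type*} [CommRing R] [Algebra ℂ R] (g : AutSpec R) (p : R) :
    g.unop (g⁻¹.unop p) = p := by
  rw [MulOpposite.unop_inv, ← AlgEquiv.mul_apply, mul_inv_cancel, AlgEquiv.one_apply]

theorem unop_eq_aeval {n : ℕ} (g : AutA n) (p : PolyRing n) :
    g.unop p = aeval (fun j => g.unop (X j)) p :=
  DFunLike.congr_fun (aeval_unique (g.unop : PolyRing n →ₐ[ℂ] PolyRing n)) p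

theorem AutA.ext_X {n : ℕ} {g h : AutA n} (H : ∀ j, g.unop (X j) = h.unop (X j)) : g = h := by
  apply MulOpposite.unop_injective
  ext p
  rw [unop_eq_aeval, unop_eq_aeval h]
  simp only [H]

theorem indAutA_reg (n i : ℕ) : (indAutA n).reg i = Algebra.adjoin ℂ
    ((Set.range fun (q : Fin n × (Fin n →₀ ℕ)) => fun g : (indAutA n).step i =>
        coeff q.2 ((g : AutA n).unop (X q.1))) ∪
     (Set.range fun (q : Fin n × (Fin n →₀ ℕ)) => fun g : (indAutA n).step i =>
        coeff q.2 ((g : AutA n)⁻¹.unop (X q.1)))) := rfl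

theorem coeff_mem_indAutA_reg {n : ℕ} (i : ℕ) (j : Fin n) (m : Fin n →₀ ℕ) :
    (fun g : (indAutA n).step i => coeff m ((g : AutA n).unop (X j))) ∈ (indAutA n).reg i := by
  rw [indAutA_reg]
  exact Algebra.subset_adjoin (Or.inl ⟨(j, m), rfl⟩)

theorem coeff_inv_mem_indAutA_reg {n : ℕ} (i : ℕ) (j : Fin n) (m : Fin n →₀ ℕ) :
    (fun g : (indAutA n).step i => coeff m ((g : AutA n)⁻¹.unop (X j))) ∈ (indAutA n).reg i := by
  rw [indAutA_reg]
  exact Algebra.subset_adjoin (Or.inr ⟨(j, m), rfl⟩)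

theorem totalDegree_le_iff_coeff {σ : Type*} {p : MvPolynomial σ ℂ} {i : ℕ} :
    p.totalDegree ≤ i ↔ ∀ m : σ →₀ ℕ, i < m.degree → coeff m p = 0 := by
  refine ⟨fun h m hm => coeff_eq_zero_of_totalDegree_lt (h.trans_lt hm), fun h => ?_⟩
  refine Finset.sup_le fun m hm => ?_
  by_contra hlt
  exact mem_support_iff.1 hm (h m (not_le.1 hlt))

section Criterion

variable {G : Type*} {V : IndData G} {n : ℕ}

theorem regularFamily_indAutA_X (j : Fin n) :
    (indAutA n).RegularFamily (fun g => g.unop (X j)) := fun i =>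
  ⟨coeff_mem_indAutA_reg i j, i, fun g => g.2 j⟩

theorem regularFamily_indAutA_inv_X (j : Fin n) :
    (indAutA n).RegularFamily (fun g => g⁻¹.unop (X j)) := fun i => by
  obtain ⟨B, hB⟩ := exists_totalDegree_inv_le n i
  exact ⟨coeff_inv_mem_indAutA_reg i j, B, fun g => hB g g.2 j⟩

/-- A map to `Aut(𝔸ⁿ)` is a morphism if its components and those of its inverse are regular
families. -/
theorem isMorphism_indAutA {f : G → AutA n} (h : ∀ j, V.RegularFamily fun x => (f x).unop (X j))
    (h' : ∀ j, V.RegularFamily fun x => (f x)⁻¹.unop (X j)) : IsMorphism V (indAutA n) f := by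
  intro i
  choose N hN using fun j => (h j i).2
  refine ⟨Finset.univ.sup N, fun x hx j =>
    (hN j ⟨x, hx⟩).trans (Finset.le_sup (f := N) (Finset.mem_univ j)), fun φ hφ => ?_⟩
  refine (?_ : (indAutA n).reg _ ≤ (V.reg i).comap (pullback (Set.MapsTo.restrict f (V.step i)
    ((indAutA n).step (Finset.univ.sup N)) _))) hφ
  rw [indAutA_reg]
  refine Algebra.adjoin_le ?_
  rintro _ (⟨q, rfl⟩ | ⟨q, rfl⟩)
  · exact (h q.1 i).1 q.2
  · exact (h' q.1 i).1 q.2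

theorem IsMorphism.regularFamily {f : G → AutA n} (hf : IsMorphism V (indAutA n) f)
    (p : PolyRing n) : V.RegularFamily fun x => (f x).unop p := by
  simp only [unop_eq_aeval _ p]
  exact (IndData.RegularFamily.const p).aeval fun j => (regularFamily_indAutA_X j).comp hf

theorem IsMorphism.regularFamily_inv {f : G → AutA n} (hf : IsMorphism V (indAutA n) f)
    (p : PolyRing n) : V.RegularFamily fun x => (f x)⁻¹.unop p := by
  simp only [unop_eq_aeval _ p]
  exact (IndData.RegularFamily.const p).aeval fun j => (regularFamily_indAutA_inv_X j).comp hf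

/-- The locus where two morphisms to `Aut(𝔸ⁿ)` agree is closed. -/
theorem IsMorphism.isClosed_eq {f g : G → AutA n} (hf : IsMorphism V (indAutA n) f)
    (hg : IsMorphism V (indAutA n) g) : V.IsClosed {x | f x = g x} := by
  have : {x | f x = g x} = ⋂ j, {x | (f x).unop (X j) = (g x).unop (X j)} := by
    ext x
    simp only [Set.mem_iInter, Set.mem_ofPred_eq]
    exact ⟨fun h j => by rw [h], AutA.ext_X⟩
  rw [this]
  exact IndData.IsClosed.iInter fun j => (hf.regularFamily _).isClosed_eq (hg.regularFamily _)

theorem isMorphism_const_indAutA (u : AutA n) : IsMorphism V (indAutA n) fun _ => u :=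
  isMorphism_indAutA (fun _ => .const _) fun _ => .const _

theorem IsMorphism.mul_indAutA {f g : G → AutA n} (hf : IsMorphism V (indAutA n) f)
    (hg : IsMorphism V (indAutA n) g) : IsMorphism V (indAutA n) fun x => f x * g x := by
  refine isMorphism_indAutA (fun j => ?_) fun j => ?_
  · have : ∀ x, (f x * g x).unop (X j) =
        aeval (fun j => (g x).unop (X j)) ((f x).unop (X j)) := fun x => by
      rw [← unop_eq_aeval, MulOpposite.unop_mul, AlgEquiv.mul_apply]
    simp only [this]
    exact (hf.regularFamily _).aeval fun j => hg.regularFamily _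
  · have : ∀ x, (f x * g x)⁻¹.unop (X j) =
        aeval (fun j => (f x)⁻¹.unop (X j)) ((g x)⁻¹.unop (X j)) := fun x => by
      rw [← unop_eq_aeval, mul_inv_rev, MulOpposite.unop_mul, AlgEquiv.mul_apply]
    simp only [this]
    exact (hg.regularFamily_inv _).aeval fun j => hf.regularFamily_inv _

theorem IsMorphism.inv_indAutA {f : G → AutA n} (hf : IsMorphism V (indAutA n) f) :
    IsMorphism V (indAutA n) fun x => (f x)⁻¹ :=
  isMorphism_indAutA (fun _ => hf.regularFamily_inv _) fun j => by
    simpa using hf.regularFamily (X j)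

end Criterion

theorem IndData.prod_reg {G H : Type*} (V : IndData G) (W : IndData H) (i : ℕ) :
    (V.prod W).reg i =
      (V.reg i).map (pullback fun x : (V.prod W).step i => (⟨x.1.1, x.2.1⟩ : V.step i)) ⊔
      (W.reg i).map (pullback fun x : (V.prod W).step i => (⟨x.1.2, x.2.2⟩ : W.step i)) := rfl

theorem isMorphism_prod_fst {G H : Type*} (V : IndData G) (W : IndData H) :
    IsMorphism (V.prod W) V Prod.fst :=
  fun i => ⟨i, fun _ hx => hx.1, fun φ hφ => by
    rw [IndData.prod_reg]
    exact Algebra.mem_sup_left ⟨φ, hφ, rfl⟩⟩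

theorem isMorphism_prod_snd {G H : Type*} (V : IndData G) (W : IndData H) :
    IsMorphism (V.prod W) W Prod.snd :=
  fun i => ⟨i, fun _ hx => hx.2, fun φ hφ => by
    rw [IndData.prod_reg]
    exact Algebra.mem_sup_right ⟨φ, hφ, rfl⟩⟩

/-- The automorphism of `𝔸ⁿ` given by two mutually inverse polynomial maps. -/
def autOfInverse {n : ℕ} (F F' : Fin n → PolyRing n) (h : ∀ j, aeval F (F' j) = X j)
    (h' : ∀ j, aeval F' (F j) = X j) : AutA n :=
  MulOpposite.op <| AlgEquiv.ofAlgHom (aeval F) (aeval F')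
    (by ext j : 1; simpa using h j) (by ext j : 1; simpa using h' j)

/-- The algebra of polynomial functions on the affine space `ℂ^ι`. -/
def polynomialFunctions (ι : Type*) : Subalgebra ℂ ((ι → ℂ) → ℂ) :=
  (aeval fun k (a : ι → ℂ) => a k : MvPolynomial ι ℂ →ₐ[ℂ] ((ι → ℂ) → ℂ)).range

theorem mem_polynomialFunctions {ι : Type*} {φ : (ι → ℂ) → ℂ} :
    φ ∈ polynomialFunctions ι ↔ ∃ q : MvPolynomial ι ℂ, ∀ a, eval a q = φ a := by
  have key : ∀ (q : MvPolynomial ι ℂ) (b : ι → ℂ),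
      aeval (fun k (a : ι → ℂ) => a k) q b = eval b q := fun q b => by
      have := comp_aeval_apply (fun k (a : ι → ℂ) => a k)
        (Pi.evalAlgHom ℂ (fun _ : ι → ℂ => ℂ) b) q
      simpa [aeval_eq_eval] using this
  constructor
  · rintro ⟨q, rfl⟩
    exact ⟨q, fun a => (key q a).symm⟩
  · rintro ⟨q, hq⟩
    exact ⟨q, funext fun a => (key q a).trans (hq a)⟩

/-- The polynomial with exponents in `s` whose coefficients are the coordinates of `a` labelled
by `k`. -/
def polyOfCoeffs {ι σ : Type*} (s : Finset (σ →₀ ℕ)) (k : s → ι) (a : ι → ℂ) : MvPolynomial σ ℂ :=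
  ∑ m : s, C (a (k m)) * monomial (m : σ →₀ ℕ) 1

theorem coeff_polyOfCoeffs {ι σ : Type*} (s : Finset (σ →₀ ℕ)) (k : s → ι) (a : ι → ℂ) (m : s) :
    coeff m (polyOfCoeffs s k a) = a (k m) := by
  classical
  simp [polyOfCoeffs, C_mul_monomial, coeff_sum, coeff_monomial]

theorem polyOfCoeffs_mem_regularFamilies {ι σ : Type*} (s : Finset (σ →₀ ℕ)) (k : s → ι) :
    polyOfCoeffs s k ∈ regularFamilies (polynomialFunctions ι) σ := by
  have : polyOfCoeffs s k = ∑ m : s, (fun a : ι → ℂ => (C (a (k m)) : MvPolynomial σ ℂ)) *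
      fun _ => monomial (m : σ →₀ ℕ) (1 : ℂ) := by
    funext a
    simp [polyOfCoeffs]
  rw [this]
  exact Subalgebra.sum_mem _ fun m _ => Subalgebra.mul_mem _
    (C_mem_regularFamilies (mem_polynomialFunctions.2 ⟨X (k m), fun a => by simp⟩))
    (const_mem_regularFamilies _ _)

theorem polyOfCoeffs_eq {ι σ : Type*} {s : Finset (σ →₀ ℕ)} {k : s → ι} {a : ι → ℂ}
    {p : MvPolynomial σ ℂ} (hp : ∀ m, m ∉ s → coeff m p = 0) (ha : ∀ m, a (k m) = coeff m p) :
    polyOfCoeffs s k a = p := by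
  classical
  ext m
  by_cases hm : m ∈ s
  · exact (coeff_polyOfCoeffs s k a ⟨m, hm⟩).trans (ha _)
  · rw [hp m hm, polyOfCoeffs, coeff_sum]
    refine Finset.sum_eq_zero fun l _ => ?_
    rw [C_mul_monomial, coeff_monomial, if_neg]
    rintro rfl
    exact hm l.2

/-- The automorphisms of degree at most `i` form an affine variety: the coefficients of `g` and
`g⁻¹` up to a common degree bound embed it into an affine space, and the image is cut out by
`g ∘ g⁻¹ = g⁻¹ ∘ g = id` and the vanishing of the coefficients of `g` of degree above `i`. -/
theorem isAffineVariety_indAutA (n i : ℕ) : IsAffineVariety ((indAutA n).reg i) := by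
  obtain ⟨B, hB⟩ := exists_totalDegree_inv_le n i
  let s : Finset (Fin n →₀ ℕ) := (Finsupp.finite_of_degree_le (σ := Fin n) (max i B)).toFinset
  have hs : ∀ (p : PolyRing n), p.totalDegree ≤ max i B → ∀ m, m ∉ s → coeff m p = 0 :=
    fun p hp m hm => by
      refine totalDegree_le_iff_coeff.1 hp m ?_
      simpa [s] using hm
  let ι := (Fin n × s) ⊕ (Fin n × s)
  let c : ι → (indAutA n).step i → ℂ := Sum.elim
    (fun q g => coeff q.2 ((g : AutA n).unop (X q.1)))
    (fun q g => coeff q.2 ((g : AutA n)⁻¹.unop (X q.1)))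
  let F : Fin n → (ι → ℂ) → PolyRing n := fun j => polyOfCoeffs s fun m => .inl (j, m)
  let F' : Fin n → (ι → ℂ) → PolyRing n := fun j => polyOfCoeffs s fun m => .inr (j, m)
  have hsg : ∀ (g : (indAutA n).step i) j m, m ∉ s → coeff m ((g : AutA n).unop (X j)) = 0 :=
    fun g j => hs _ ((g.2 j).trans (le_max_left _ _))
  have hsg' : ∀ (g : (indAutA n).step i) j m, m ∉ s → coeff m ((g : AutA n)⁻¹.unop (X j)) = 0 :=
    fun g j => hs _ ((hB g g.2 j).trans (le_max_right _ _))
  have hF : ∀ (g : (indAutA n).step i) j, F j (fun k => c k g) = (g : AutA n).unop (X j) :=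
    fun g j => polyOfCoeffs_eq (hsg g j) fun _ => rfl
  have hF' : ∀ (g : (indAutA n).step i) j, F' j (fun k => c k g) = (g : AutA n)⁻¹.unop (X j) :=
    fun g j => polyOfCoeffs_eq (hsg' g j) fun _ => rfl
  refine isAffineVariety_of_fintype c ?_ ?_ ?_
  · rw [indAutA_reg]
    apply le_antisymm
    · refine Algebra.adjoin_le ?_
      rintro _ (⟨⟨j, m⟩, rfl⟩ | ⟨⟨j, m⟩, rfl⟩)
      · by_cases hm : m ∈ s
        · exact Algebra.subset_adjoin ⟨.inl (j, ⟨m, hm⟩), rfl⟩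
        · have h0 := _root_.funext fun g => hsg g j m hm
          exact (congrArg (· ∈ Algebra.adjoin ℂ (Set.range c)) h0).mpr (Subalgebra.zero_mem _)
      · by_cases hm : m ∈ s
        · exact Algebra.subset_adjoin ⟨.inr (j, ⟨m, hm⟩), rfl⟩
        · have h0 := _root_.funext fun g => hsg' g j m hm
          exact (congrArg (· ∈ Algebra.adjoin ℂ (Set.range c)) h0).mpr (Subalgebra.zero_mem _)
    · refine Algebra.adjoin_mono ?_
      rintro _ ⟨(q | q), rfl⟩
      · exact Or.inl ⟨(q.1, q.2), rfl⟩
      · exact Or.inr ⟨(q.1, q.2), rfl⟩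
  · intro g h hgh
    refine Subtype.ext (AutA.ext_X fun j => ?_)
    rw [← hF g, ← hF h]
    exact congrArg (F j) hgh
  · intro a ha
    have hA : ∀ φ ∈ polynomialFunctions ι, (∀ g, φ (fun k => c k g) = 0) → φ a = 0 := by
      intro φ hφ h
      obtain ⟨q, hq⟩ := mem_polynomialFunctions.1 hφ
      rw [← hq]
      exact ha q fun g => (hq _).trans (h g)
    have hA' : ∀ {P Q : (ι → ℂ) → PolyRing n},
        P ∈ regularFamilies (polynomialFunctions ι) (Fin n) →
        Q ∈ regularFamilies (polynomialFunctions ι) (Fin n) →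
        (∀ g, P (fun k => c k g) = Q (fun k => c k g)) → P a = Q a := by
      intro P Q hP hQ h
      ext m
      rw [← sub_eq_zero]
      refine hA ((fun a => coeff m (P a)) - fun a => coeff m (Q a))
        (Subalgebra.sub_mem _ (hP.1 m) (hQ.1 m)) fun g => ?_
      simp [h g]
    have hFA : ∀ j, F j ∈ regularFamilies (polynomialFunctions ι) (Fin n) := fun j =>
      polyOfCoeffs_mem_regularFamilies _ _
    have hFA' : ∀ j, F' j ∈ regularFamilies (polynomialFunctions ι) (Fin n) := fun j =>
      polyOfCoeffs_mem_regularFamilies _ _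
    have h1 : ∀ j, aeval (fun l => F l a) (F' j a) = X j := fun j =>
      hA' (aeval_mem_regularFamilies (hFA' j) hFA) (const_mem_regularFamilies _ _) fun g => by
        simp only [hF, hF']
        rw [← unop_eq_aeval, unop_unop_inv]
    have h2 : ∀ j, aeval (fun l => F' l a) (F j a) = X j := fun j =>
      hA' (aeval_mem_regularFamilies (hFA j) hFA') (const_mem_regularFamilies _ _) fun g => by
        simp only [hF, hF']
        rw [← unop_eq_aeval, unop_inv_unop]
    let g : AutA n := autOfInverse _ _ h1 h2
    have hgX : ∀ j, g.unop (X j) = F j a := fun j => aeval_X _ j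
    have hgX' : ∀ j, g⁻¹.unop (X j) = F' j a := fun j => aeval_X _ j
    have hg : g ∈ (indAutA n).step i := fun j => by
      rw [hgX]
      refine totalDegree_le_iff_coeff.2 fun m hm => ?_
      refine hA (fun a => coeff m (F j a)) ((hFA j).1 m) fun g => ?_
      rw [hF]
      exact totalDegree_le_iff_coeff.1 (g.2 j) m hm
    refine ⟨⟨g, hg⟩, ?_⟩
    funext k
    rcases k with ⟨j, m⟩ | ⟨j, m⟩
    · change coeff _ (g.unop (X j)) = _
      rw [hgX]
      exact coeff_polyOfCoeffs _ _ _ m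
    · change coeff _ (g⁻¹.unop (X j)) = _
      rw [hgX']
      exact coeff_polyOfCoeffs _ _ _ m

theorem isIndVariety_indAutA (n : ℕ) : IsIndVariety (indAutA n) where
  mono i g hg j := (hg j).trans (Nat.le_succ i)
  exhaust g := ⟨Finset.univ.sup fun j => (g.unop (X j)).totalDegree, fun j =>
    Finset.le_sup (f := fun j => (g.unop (X j)).totalDegree) (Finset.mem_univ j)⟩
  affine := isAffineVariety_indAutA n
  closed i := by
    refine ⟨{φ | ∃ j, ∃ m : Fin n →₀ ℕ, i < m.degree ∧
      φ = fun g : (indAutA n).step (i + 1) => coeff m ((g : AutA n).unop (X j))}, ?_, ?_⟩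
    · rintro _ ⟨j, m, _, rfl⟩
      exact coeff_mem_indAutA_reg _ _ _
    · ext g
      constructor
      · rintro hg _ ⟨j, m, hm, rfl⟩
        exact totalDegree_le_iff_coeff.1 (hg j) m hm
      · intro h j
        exact totalDegree_le_iff_coeff.2 fun m hm => h _ ⟨j, m, hm, rfl⟩
  restrict i := by
    rw [indAutA_reg, indAutA_reg, AlgHom.map_adjoin, Set.image_union, ← Set.range_comp,
      ← Set.range_comp]
    rfl

theorem isIndGroup_indAutA (n : ℕ) : IsIndGroup (indAutA n) where
  indVariety := isIndVariety_indAutA n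
  morphism := (isMorphism_prod_fst _ _).mul_indAutA (isMorphism_prod_snd _ _).inv_indAutA

/-! ### Exponentials of locally nilpotent derivations -/

section Exp

variable {n : ℕ} {D D' : Der n} {u : AutA n}

theorem iterate_derivation_eq_pow (D : Der n) (i : ℕ) (f : PolyRing n) :
    D^[i] f = ((D : PolyRing n →ₗ[ℂ] PolyRing n) ^ i) f := by
  rw [Module.End.pow_apply]
  rfl

theorem iterate_eq_zero_of_le {f : PolyRing n} {m i : ℕ} (hm : D^[m] f = 0) (hi : m ≤ i) :
    D^[i] f = 0 := by
  obtain ⟨j, rfl⟩ := Nat.exists_eq_add_of_le' hi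
  rw [Function.iterate_add_apply, hm, iterate_derivation_eq_pow, map_zero]

theorem finsum_exp_eq_sum {f : PolyRing n} {m : ℕ} (hm : D^[m] f = 0) :
    ∑ᶠ i : ℕ, ((i.factorial : ℂ)⁻¹) • D^[i] f =
      ∑ i ∈ Finset.range m, ((i.factorial : ℂ)⁻¹) • D^[i] f := by
  refine finsum_eq_sum_of_support_subset _ fun i hi => ?_
  by_contra h
  refine hi ?_
  simp only [Finset.coe_range, Set.mem_Iio, not_lt] at h
  simp only [iterate_eq_zero_of_le hm h, smul_zero]

/-- The powers of `Exp(D)` are the `Exp(k D)`. -/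
theorem IsExp.iterate_apply (hu : IsExp D u) {f : PolyRing n} {m : ℕ} (hm : D^[m] f = 0) (k : ℕ) :
    u.unop^[k] f = ∑ i ∈ Finset.range m, (k : ℂ) ^ i • ((i.factorial : ℂ)⁻¹ • D^[i] f) := by
  set L : Module.End ℂ (PolyRing n) := (D : PolyRing n →ₗ[ℂ] PolyRing n) with hL
  set E : Polynomial ℂ := PowerSeries.trunc m (PowerSeries.exp ℂ) with hE
  have hLm : (L ^ m) f = 0 := by rw [← hm, iterate_derivation_eq_pow]
  have hu' : ∀ h : PolyRing n, (L ^ m) h = 0 → u.unop h = Polynomial.aeval L E h := fun h hh => by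
    rw [hu h, finsum_exp_eq_sum (m := m) (by rw [iterate_derivation_eq_pow]; exact hh), hE,
      PowerSeries.trunc_apply, map_sum, LinearMap.sum_apply, ← Finset.range_eq_Ico]
    refine Finset.sum_congr rfl fun i _ => ?_
    rw [Polynomial.aeval_monomial, PowerSeries.coeff_exp, iterate_derivation_eq_pow]
    simp [hL, Algebra.algebraMap_eq_smul_one]
  have hpow : ∀ k : ℕ, u.unop^[k] f = Polynomial.aeval L (E ^ k) f := by
    intro k
    induction k with
    | zero => simp
    | succ k ih =>
      rw [Function.iterate_succ_apply', ih, hu', pow_succ', map_mul, Module.End.mul_apply]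
      have : L ^ m = Polynomial.aeval L (Polynomial.X ^ m : Polynomial ℂ) := by simp
      rw [this, ← Module.End.mul_apply, ← map_mul, mul_comm, map_mul, Module.End.mul_apply, ← this,
        hLm, map_zero]
  -- modulo `X ^ m` the powers of the truncated exponential are the rescaled exponentials
  have hmod : Polynomial.X ^ m ∣ E ^ k - PowerSeries.trunc m (PowerSeries.exp ℂ ^ k) := by
    rw [Polynomial.X_pow_dvd_iff]
    intro i hi
    rw [Polynomial.coeff_sub, sub_eq_zero, ← PowerSeries.trunc_trunc_pow, PowerSeries.coeff_trunc,
      if_pos hi, ← Polynomial.coeff_coe, Polynomial.coe_pow]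
  obtain ⟨q, hq⟩ := hmod
  rw [hpow, sub_eq_iff_eq_add.1 hq, map_add, LinearMap.add_apply, mul_comm, map_mul,
    Module.End.mul_apply, map_pow, Polynomial.aeval_X, hLm, map_zero, zero_add,
    PowerSeries.exp_pow_eq_rescale_exp, PowerSeries.trunc_apply, map_sum, LinearMap.sum_apply,
    ← Finset.range_eq_Ico]
  refine Finset.sum_congr rfl fun i _ => ?_
  rw [Polynomial.aeval_monomial, PowerSeries.coeff_rescale, PowerSeries.coeff_exp,
    iterate_derivation_eq_pow]
  simp [hL, Algebra.algebraMap_eq_smul_one, smul_smul]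

theorem eq_zero_of_sum_pow_smul_eq_zero {a : ℕ → PolyRing n} {m : ℕ}
    (h : ∀ k : ℕ, ∑ i ∈ Finset.range m, (k : ℂ) ^ i • a i = 0) {i : ℕ} (hi : i < m) : a i = 0 := by
  ext μ
  let p : Polynomial ℂ := ∑ i ∈ Finset.range m, Polynomial.monomial i (coeff μ (a i))
  have hp : p = 0 := by
    refine Polynomial.eq_zero_of_infinite_isRoot p ?_
    refine Set.infinite_of_injective_forall_mem Nat.cast_injective fun k : ℕ => ?_
    have := congrArg (coeff μ) (h k)
    rw [coeff_sum, coeff_zero] at this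
    change p.eval (k : ℂ) = 0
    rw [← this, Polynomial.eval_finsetSum]
    refine Finset.sum_congr rfl fun i _ => ?_
    rw [Polynomial.eval_monomial, coeff_smul, smul_eq_mul, mul_comm]
  have hc : p.coeff i = coeff μ (a i) := by
    simp only [p, Polynomial.finsetSum_coeff, Polynomial.coeff_monomial]
    rw [Finset.sum_ite_eq' (Finset.range m) i, if_pos (Finset.mem_range.2 hi)]
  rw [← hc, hp]
  simp

/-- `D f` is the coefficient of `k` in the polynomial function `k ↦ Exp(D)ᵏ f`. -/
theorem derivation_eq_of_iterate (hD : IsLocallyNilpotent D) (hu : IsExp D u) {f : PolyRing n}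
    {b : ℕ → PolyRing n} {N : ℕ} (hN : 1 < N)
    (h : ∀ k : ℕ, u.unop^[k] f = ∑ i ∈ Finset.range N, (k : ℂ) ^ i • b i) : D f = b 1 := by
  obtain ⟨m, hm⟩ := hD f
  have hm' := iterate_eq_zero_of_le hm (le_max_left m N)
  have key := eq_zero_of_sum_pow_smul_eq_zero (m := max m N) (i := 1)
    (a := fun i => (i.factorial : ℂ)⁻¹ • D^[i] f - if i < N then b i else 0) (fun k => by
      simp only [smul_sub, Finset.sum_sub_distrib]
      rw [← hu.iterate_apply hm' k, h k, sub_eq_zero]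
      rw [← Finset.sum_subset (Finset.range_mono (le_max_right m N))]
      · refine Finset.sum_congr rfl fun i hi => ?_
        rw [if_pos (Finset.mem_range.1 hi)]
      · intro i _ hi
        rw [if_neg (fun h => hi (Finset.mem_range.2 h)), smul_zero]) (lt_max_of_lt_right hN)
  simp only [if_pos hN, Nat.factorial_one, Nat.cast_one, inv_one, one_smul, sub_eq_zero] at key
  exact key

/-- A unipotent automorphism is the exponential of a unique locally nilpotent derivation. -/
theorem IsExp.derivation_unique (hD : IsLocallyNilpotent D) (hu : IsExp D u)
    (hD' : IsLocallyNilpotent D') (hu' : IsExp D' u) : D = D' := by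
  apply Derivation.ext
  intro f
  obtain ⟨m, hm⟩ := hD' f
  rw [derivation_eq_of_iterate hD hu (N := m + 2) (by omega)
    (hu'.iterate_apply (iterate_eq_zero_of_le hm (Nat.le_add_right m 2)))]
  simp

theorem iterate_smul_derivation {b : PolyRing n} (hb : D b = 0) (i : ℕ) (f : PolyRing n) :
    (b • D)^[i] f = b ^ i * D^[i] f := by
  induction i with
  | zero => simp
  | succ i ih =>
    rw [Function.iterate_succ_apply', ih, Function.iterate_succ_apply']
    simp [Derivation.leibniz_pow, hb, pow_succ']
    ring

theorem IsLocallyNilpotent.smul (hD : IsLocallyNilpotent D) {b : PolyRing n} (hb : D b = 0) :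
    IsLocallyNilpotent (b • D) := fun f => by
  obtain ⟨m, hm⟩ := hD f
  exact ⟨m, by rw [iterate_smul_derivation hb, hm, mul_zero]⟩

/-- Leibniz rule for iterates of a derivation. -/
theorem iterate_derivation_mul (D : Der n) (f g : PolyRing n) (m : ℕ) :
    D^[m] (f * g) = ∑ ij ∈ Finset.HasAntidiagonal.antidiagonal m,
      m.choose ij.1 • (D^[ij.1] f * D^[ij.2] g) := by
  induction m with
  | zero => simp
  | succ m ih =>
    rw [Function.iterate_succ_apply', ih, map_sum,
      Finset.sum_antidiagonal_choose_succ_nsmul (fun i j => D^[i] f * D^[j] g) m,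
      ← Finset.sum_add_distrib]
    refine Finset.sum_congr rfl fun ij hij => ?_
    have : m.choose ij.2 = m.choose ij.1 :=
      Nat.choose_symm_of_eq_add (by rw [Finset.HasAntidiagonal.mem_antidiagonal] at hij; omega)
    rw [this, map_nsmul, Derivation.leibniz, ← smul_add, Function.iterate_succ_apply',
      Function.iterate_succ_apply']
    simp only [smul_eq_mul]
    congr 1
    ring

/-- The generating polynomial of the divided powers `Dⁱ f / i!`; its value at `1` is
`Exp(D)* f`. -/
theorem IsLocallyNilpotent.exists_generating (hD : IsLocallyNilpotent D) (f : PolyRing n) :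
    ∃ p : Polynomial (PolyRing n), (∀ i, p.coeff i = (i.factorial : ℂ)⁻¹ • D^[i] f) ∧
      p.eval 1 = ∑ᶠ i : ℕ, ((i.factorial : ℂ)⁻¹) • D^[i] f := by
  obtain ⟨m, hm⟩ := hD f
  refine ⟨∑ i ∈ Finset.range m, Polynomial.monomial i ((i.factorial : ℂ)⁻¹ • D^[i] f),
    fun i => ?_, ?_⟩
  · simp only [Polynomial.finsetSum_coeff, Polynomial.coeff_monomial]
    rw [Finset.sum_ite_eq' (Finset.range m) i]
    split_ifs with h
    · rfl
    · rw [iterate_eq_zero_of_le hm (not_lt.1 fun h' => h (Finset.mem_range.2 h')), smul_zero]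
  · rw [finsum_exp_eq_sum hm, Polynomial.eval_finsetSum]
    simp

/-- The exponential of a locally nilpotent derivation is multiplicative. -/
theorem IsLocallyNilpotent.finsum_exp_mul (hD : IsLocallyNilpotent D) (f g : PolyRing n) :
    ∑ᶠ i : ℕ, ((i.factorial : ℂ)⁻¹) • D^[i] (f * g) =
      (∑ᶠ i : ℕ, ((i.factorial : ℂ)⁻¹) • D^[i] f) * ∑ᶠ i : ℕ, ((i.factorial : ℂ)⁻¹) • D^[i] g := by
  obtain ⟨p, hp, hp'⟩ := hD.exists_generating f
  obtain ⟨q, hq, hq'⟩ := hD.exists_generating g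
  obtain ⟨r, hr, hr'⟩ := hD.exists_generating (f * g)
  rw [← hp', ← hq', ← hr', ← Polynomial.eval_mul]
  congr 1
  ext1 m
  rw [hr, Polynomial.coeff_mul, iterate_derivation_mul, Finset.smul_sum]
  refine Finset.sum_congr rfl fun ij hij => ?_
  rw [Finset.HasAntidiagonal.mem_antidiagonal] at hij
  subst hij
  rw [hp, hq, smul_mul_smul_comm, ← Nat.cast_smul_eq_nsmul ℂ, smul_smul]
  congr 1
  have h1 := Nat.add_choose_mul_factorial_mul_factorial ij.1 ij.2
  rw [← Nat.choose_symm_add] at h1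
  have h2 : ((ij.1 + ij.2).choose ij.1 : ℂ) * ij.1.factorial * ij.2.factorial =
      (ij.1 + ij.2).factorial := by exact_mod_cast h1
  have := Nat.cast_ne_zero (R := ℂ).2 ij.1.factorial_ne_zero
  have := Nat.cast_ne_zero (R := ℂ).2 ij.2.factorial_ne_zero
  have := Nat.cast_ne_zero (R := ℂ).2 (ij.1 + ij.2).factorial_ne_zero
  field_simp
  linear_combination h2

theorem IsLocallyNilpotent.finsum_exp_add (hD : IsLocallyNilpotent D) (f g : PolyRing n) :
    ∑ᶠ i : ℕ, ((i.factorial : ℂ)⁻¹) • D^[i] (f + g) =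
      (∑ᶠ i : ℕ, ((i.factorial : ℂ)⁻¹) • D^[i] f) + ∑ᶠ i : ℕ, ((i.factorial : ℂ)⁻¹) • D^[i] g := by
  obtain ⟨m, hm⟩ := hD f
  obtain ⟨l, hl⟩ := hD g
  have h1 := iterate_eq_zero_of_le hm (le_max_left m l)
  have h2 := iterate_eq_zero_of_le hl (le_max_right m l)
  have h3 : ∀ i, D^[i] (f + g) = D^[i] f + D^[i] g := fun i => by
    simp only [iterate_derivation_eq_pow, map_add]
  rw [finsum_exp_eq_sum h1, finsum_exp_eq_sum h2,
    finsum_exp_eq_sum (m := max m l) (by rw [h3, h1, h2, add_zero]), ← Finset.sum_add_distrib]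
  simp only [h3, smul_add]

/-- An automorphism is the exponential of `D` as soon as this holds on a system of coordinates. -/
theorem isExp_of_coordinates (hD : IsLocallyNilpotent D) (c : PolyRing n ≃ₐ[ℂ] PolyRing n)
    (h : ∀ j, u.unop (c (X j)) = ∑ᶠ i : ℕ, ((i.factorial : ℂ)⁻¹) • D^[i] (c (X j))) :
    IsExp D u := by
  intro f
  obtain ⟨p, rfl⟩ := c.surjective f
  induction p using MvPolynomial.induction_on with
  | C a =>
    have : D^[1] (c (C a)) = 0 := by
      rw [← algebraMap_eq, AlgEquiv.commutes]
      exact D.map_algebraMap a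
    rw [finsum_exp_eq_sum this, ← algebraMap_eq, AlgEquiv.commutes, AlgEquiv.commutes]
    simp
  | add p q hp hq => rw [map_add, map_add, hp, hq, hD.finsum_exp_add]
  | mul_X p j hp => rw [map_mul, map_mul, hp, h, hD.finsum_exp_mul]

theorem finsum_exp_of_sq_eq_zero {f : PolyRing n} (hf : D (D f) = 0) :
    ∑ᶠ i : ℕ, ((i.factorial : ℂ)⁻¹) • D^[i] f = f + D f := by
  rw [finsum_exp_eq_sum (m := 2) hf]
  simp [Finset.sum_range_succ]

theorem IsExp.apply_of_sq_eq_zero (hu : IsExp D u) {f : PolyRing n} (hf : D (D f) = 0) :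
    u.unop f = f + D f :=
  (hu f).trans (finsum_exp_of_sq_eq_zero hf)

theorem IsExp.apply_of_eq_zero (hu : IsExp D u) {f : PolyRing n} (hf : D f = 0) :
    u.unop f = f := by
  rw [hu.apply_of_sq_eq_zero (by rw [hf, map_zero]), hf, add_zero]

end Exp

/-! ### Coordinates of space extending coordinates of the plane -/

/-- The endomorphism of `ℂ[X₀, X₁, X₂]` that multiplies `X₀` by `z` and acts by `φ` on
`ℂ[X₁, X₂]`, where the plane has its coordinates `X₀, X₁` placed as `X₁, X₂`. -/
def extendHom (z : ℂ) (φ : PolyRing 2 →ₐ[ℂ] PolyRing 2) : PolyRing 3 →ₐ[ℂ] PolyRing 3 :=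
  aeval (Fin.cons (C z * X 0) fun j => rename Fin.succ (φ (X j)))

@[simp] theorem extendHom_X_zero (z : ℂ) (φ : PolyRing 2 →ₐ[ℂ] PolyRing 2) :
    extendHom z φ (X 0) = C z * X 0 := by
  simp [extendHom]

@[simp] theorem extendHom_rename (z : ℂ) (φ : PolyRing 2 →ₐ[ℂ] PolyRing 2) (p : PolyRing 2) :
    extendHom z φ (rename Fin.succ p) = rename Fin.succ (φ p) := by
  have : (extendHom z φ).comp (rename Fin.succ) = (rename Fin.succ).comp φ := by
    ext j : 1
    simp [extendHom]
  exact DFunLike.congr_fun this p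

theorem algHom_ext_succ {A : Type*} [CommRing A] [Algebra ℂ A] {f g : PolyRing 3 →ₐ[ℂ] A}
    (h0 : f (X 0) = g (X 0))
    (h : ∀ p : PolyRing 2, f (rename Fin.succ p) = g (rename Fin.succ p)) : f = g := by
  ext j : 1
  refine Fin.cases h0 (fun k => ?_) j
  simpa using h (X k)

theorem extendHom_comp (z w : ℂ) (φ ψ : PolyRing 2 →ₐ[ℂ] PolyRing 2) :
    (extendHom z φ).comp (extendHom w ψ) = extendHom (z * w) (φ.comp ψ) := by
  refine algHom_ext_succ ?_ fun p => ?_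
  · simp only [AlgHom.comp_apply, extendHom_X_zero, map_mul]
    rw [← algebraMap_eq, AlgHom.commutes]
    ring
  · simp

theorem extendHom_one : extendHom 1 (AlgHom.id ℂ (PolyRing 2)) = AlgHom.id ℂ (PolyRing 3) :=
  algHom_ext_succ (by simp) (by simp)

/-- The automorphism of `ℂ[X₀, X₁, X₂]` that multiplies `X₀` by the unit `z` and acts by the
automorphism `φ` on `ℂ[X₁, X₂]`. -/
def extendEquiv (z : ℂˣ) (φ : PolyRing 2 ≃ₐ[ℂ] PolyRing 2) : PolyRing 3 ≃ₐ[ℂ] PolyRing 3 :=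
  AlgEquiv.ofAlgHom (extendHom z φ) (extendHom ↑z⁻¹ φ.symm)
    (by
      rw [extendHom_comp, Units.mul_inv, ← extendHom_one]
      congr 1
      ext j : 1
      simp)
    (by
      rw [extendHom_comp, Units.inv_mul, ← extendHom_one]
      congr 1
      ext j : 1
      simp)

theorem extendEquiv_apply (z : ℂˣ) (φ : PolyRing 2 ≃ₐ[ℂ] PolyRing 2) (p : PolyRing 3) :
    extendEquiv z φ p = extendHom z φ p := rfl

theorem extendEquiv_mul (z w : ℂˣ) (φ ψ : PolyRing 2 ≃ₐ[ℂ] PolyRing 2) (p : PolyRing 3) :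
    extendEquiv (z * w) (φ * ψ) p = extendEquiv z φ (extendEquiv w ψ p) := by
  simp only [extendEquiv_apply]
  rw [← AlgHom.comp_apply, extendHom_comp]
  rfl

theorem extendEquiv_one (p : PolyRing 3) : extendEquiv 1 1 p = p := by
  rw [extendEquiv_apply]
  exact DFunLike.congr_fun extendHom_one p

/-- A polynomial with vanishing partial derivative in `X₀` does not involve `X₀`. -/
theorem exists_rename_of_pderiv_eq_zero {p : PolyRing 3} (hp : pderiv 0 p = 0) :
    ∃ q : PolyRing 2, rename Fin.succ q = p := by
  refine exists_rename_eq_of_vars_subset_range p Fin.succ (Fin.succ_injective 2) ?_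
  intro i hi
  refine Fin.cases (fun h0 => ?_) (fun k _ => ⟨k, rfl⟩) i hi
  exfalso
  obtain ⟨m, hm, hm0⟩ := (mem_vars_iff_mem_support 0).1 h0
  have h := congrArg (coeff (m - Finsupp.single 0 1)) hp
  have hle : Finsupp.single 0 1 ≤ m := by
    rw [Finsupp.single_le_iff]
    exact Nat.one_le_iff_ne_zero.2 (Finsupp.mem_support_iff.1 hm0)
  rw [coeff_pderiv, tsub_add_cancel_of_le hle, coeff_zero] at h
  rcases mul_eq_zero.1 h with h | h
  · exact mem_support_iff.1 hm h
  · exact absurd h (Nat.cast_add_one_ne_zero _)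

/-- `c` are coordinates of `𝔸³` in which the derivation `D` is `∂/∂X₀`: it maps the first coordinate
to `1` and kills the polynomials in the other two, written as images of `PolyRing 2` under
`rename Fin.succ`. -/
structure IsStraightening (D : Der 3) (c : PolyRing 3 ≃ₐ[ℂ] PolyRing 3) : Prop where
  apply_zero : D (c (X 0)) = 1
  apply_rename : ∀ p : PolyRing 2, D (c (rename Fin.succ p)) = 0

namespace IsStraightening

variable {D : Der 3} {c : PolyRing 3 ≃ₐ[ℂ] PolyRing 3}

theorem of_coordinates (h0 : D (c (X 0)) = 1) (h1 : D (c (X 1)) = 0) (h2 : D (c (X 2)) = 0) :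
    IsStraightening D c where
  apply_zero := h0
  apply_rename p := by
    induction p using MvPolynomial.induction_on with
    | C a => rw [rename_C, ← algebraMap_eq, AlgEquiv.commutes, Derivation.map_algebraMap]
    | add p q hp hq => rw [map_add, map_add, map_add, hp, hq, add_zero]
    | mul_X p j hp =>
      have : D (c (rename Fin.succ (X j : PolyRing 2))) = 0 := by
        rw [rename_X]
        match j with
        | 0 => exact h1
        | 1 => exact h2
      rw [map_mul, map_mul, Derivation.leibniz, hp, this, smul_zero, smul_zero, add_zero]

theorem apply_eq (hc : IsStraightening D c) (p : PolyRing 3) : D (c p) = c (pderiv 0 p) := by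
  let E : Der 3 := Derivation.mk' (c.symm.toLinearMap ∘ₗ (D : PolyRing 3 →ₗ[ℂ] PolyRing 3) ∘ₗ
    c.toLinearMap) fun a b => by simp
  have hE : E = pderiv 0 := by
    refine derivation_ext fun j => ?_
    refine Fin.cases ?_ (fun k => ?_) j
    · change c.symm (D (c (X 0))) = _
      rw [hc.apply_zero]
      simp
    · change c.symm (D (c (X k.succ))) = _
      have := hc.apply_rename (X k)
      rw [rename_X] at this
      rw [this, pderiv_X_of_ne (Fin.succ_ne_zero k), map_zero]
  rw [← hE]
  change _ = c (c.symm (D (c p)))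
  simp

theorem apply_succ (hc : IsStraightening D c) (j : Fin 2) : D (c (X j.succ)) = 0 := by
  have := hc.apply_rename (X j)
  rwa [rename_X] at this

theorem eq_zero_iff (hc : IsStraightening D c) (f : PolyRing 3) :
    D f = 0 ↔ ∃ p : PolyRing 2, c (rename Fin.succ p) = f := by
  constructor
  · intro h
    obtain ⟨q, rfl⟩ := c.surjective f
    rw [hc.apply_eq, map_eq_zero_iff c c.injective] at h
    obtain ⟨p, rfl⟩ := exists_rename_of_pderiv_eq_zero h
    exact ⟨p, rfl⟩
  · rintro ⟨p, rfl⟩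
    exact hc.apply_rename p

variable {B : Subalgebra ℂ (PolyRing 3)}

/-- In straightening coordinates the kernel of the derivation is a polynomial ring in the last
two coordinates. -/
theorem exists_planeCoordinates (hc : IsStraightening D c) (hB : ∀ f, f ∈ B ↔ D f = 0) :
    ∃ w : PolyRing 2 ≃ₐ[ℂ] B, ∀ p, (w p : PolyRing 3) = c (rename Fin.succ p) := by
  let w : PolyRing 2 →ₐ[ℂ] B := ((c : PolyRing 3 →ₐ[ℂ] PolyRing 3).comp
    (rename Fin.succ)).codRestrict B fun p => (hB _).2 (hc.apply_rename p)
  have hw : Function.Bijective w := by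
    constructor
    · intro p q hpq
      exact rename_injective _ (Fin.succ_injective 2) (c.injective (congrArg Subtype.val hpq))
    · rintro ⟨f, hf⟩
      obtain ⟨p, hp⟩ := (hc.eq_zero_iff f).1 ((hB f).1 hf)
      exact ⟨p, Subtype.ext hp⟩
  exact ⟨AlgEquiv.ofBijective w hw, fun p => rfl⟩

/-- Straightening coordinates can be adapted to any coordinates of the quotient plane. -/
theorem exists_adapted (hc : IsStraightening D c) (hB : ∀ f, f ∈ B ↔ D f = 0)
    (v : PolyRing 2 ≃ₐ[ℂ] B) : ∃ c' : PolyRing 3 ≃ₐ[ℂ] PolyRing 3, IsStraightening D c' ∧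
      ∀ p, (v p : PolyRing 3) = c' (rename Fin.succ p) := by
  obtain ⟨w, hw⟩ := hc.exists_planeCoordinates hB
  let c' := (extendEquiv 1 (v.trans w.symm)).trans c
  have hv : ∀ p, (v p : PolyRing 3) = c' (rename Fin.succ p) := fun p => by
    change _ = c (extendEquiv 1 (v.trans w.symm) _)
    rw [extendEquiv_apply, extendHom_rename, ← hw]
    simp
  refine ⟨c', ⟨?_, fun p => ?_⟩, hv⟩
  · change D (c (extendEquiv 1 (v.trans w.symm) _)) = 1
    rw [extendEquiv_apply, extendHom_X_zero]
    simpa using hc.apply_zero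
  · rw [← hv, ← hB]
    exact (v p).2

end IsStraightening

/-! ### Automorphisms preserving a principal subscheme of the plane -/

section Character

variable {R : Type*} [CommRing R] [Algebra ℂ R] [IsDomain R] {a : R}

/-- When all units are constants, an automorphism preserves the subscheme `a = 0` exactly if it
multiplies `a` by a constant. -/
theorem mem_autPreserving_span_iff (hU : ∀ r : R, IsUnit r → ∃ z : ℂ, r = algebraMap ℂ R z)
    (ha : a ≠ 0) {g : AutSpec R} :
    g ∈ autPreserving (Ideal.span {a}) ↔ ∃ z : ℂ, g.unop a = z • a := by
  constructor
  · intro hg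
    have hg' : ∀ x, g.unop x ∈ Ideal.span {a} ↔ x ∈ Ideal.span {a} := fun x => Ideal.ext_iff.1 hg x
    obtain ⟨b, hb⟩ := Ideal.mem_span_singleton.1 ((hg' a).2 (Ideal.mem_span_singleton_self a))
    have h2 : g⁻¹.unop a ∈ Ideal.span {a} := by
      rw [← hg', unop_unop_inv]
      exact Ideal.mem_span_singleton_self a
    obtain ⟨k, hk⟩ := Ideal.mem_span_singleton.1 h2
    have h3 : a * 1 = a * (b * g.unop k) := by
      rw [← mul_assoc, ← hb, ← map_mul, ← hk, unop_unop_inv, mul_one]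
    obtain ⟨z, hz⟩ := hU b (IsUnit.of_mul_eq_one _ (mul_left_cancel₀ ha h3).symm)
    exact ⟨z, by rw [hb, hz, Algebra.smul_def, mul_comm]⟩
  · rintro ⟨z, hz⟩
    have hz0 : z ≠ 0 := by
      rintro rfl
      rw [zero_smul, map_eq_zero_iff _ g.unop.injective] at hz
      exact ha hz
    have hz' : g.unop (z⁻¹ • a) = a := by rw [map_smul, hz, inv_smul_smul₀ hz0]
    change Ideal.comap _ _ = _
    ext x
    simp only [Ideal.mem_comap, RingHom.coe_coe, Ideal.mem_span_singleton]
    constructor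
    · rintro ⟨y, hy⟩
      refine ⟨z⁻¹ • g⁻¹.unop y, g.unop.injective ?_⟩
      rw [hy, mul_smul_comm, ← smul_mul_assoc, map_mul, hz', unop_unop_inv]
    · rintro ⟨y, rfl⟩
      exact ⟨z • g.unop y, by rw [map_mul, hz, smul_mul_assoc, mul_smul_comm]⟩

/-- The character of `Aut(Spec R, V(a))` by which it acts on the equation `a`. -/
theorem exists_character (hU : ∀ r : R, IsUnit r → ∃ z : ℂ, r = algebraMap ℂ R z) (ha : a ≠ 0) :
    ∃ χ : autPreserving (Ideal.span {a}) →* ℂˣ,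
      ∀ g : autPreserving (Ideal.span {a}), (g : AutSpec R).unop a = (χ g : ℂ) • a := by
  have hinj : ∀ {z w : ℂ}, z • a = w • a → z = w := fun {z w} h =>
    smul_left_injective ℂ ha h
  -- the constants are unique as `a ≠ 0`, which makes them multiplicative in `g`
  choose z hz using fun g : autPreserving (Ideal.span {a}) =>
    (mem_autPreserving_span_iff hU ha).1 g.2
  have h1 : z 1 = 1 := hinj (by rw [← hz, one_smul]; rfl)
  have hmul : ∀ g h, z (g * h) = z g * z h := fun g h => hinj <| by
    rw [← hz, Subgroup.coe_mul, MulOpposite.unop_mul, AlgEquiv.mul_apply, hz, map_smul, hz,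
      smul_smul]
  let χ : autPreserving (Ideal.span {a}) →* ℂ := ⟨⟨z, h1⟩, hmul⟩
  exact ⟨χ.toHomUnits, hz⟩

end Character

/-! ### The centralizer of a modified translation -/

section Centralizer

variable {u : AutA 3} {D D₀ : Der 3} {c : PolyRing 3 ≃ₐ[ℂ] PolyRing 3} {f : PolyRing 3}

theorem exists_isStraightening {t : AutA 3} (ht : IsTranslation t) (hD : IsLocallyNilpotent D₀)
    (hexp : IsExp D₀ t) : ∃ c, IsStraightening D₀ c := by
  obtain ⟨c, h0, h1, h2⟩ := ht
  refine ⟨c, .of_coordinates ?_ ((mem_invariants_iff hD hexp _).1 h1)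
    ((mem_invariants_iff hD hexp _).1 h2)⟩
  -- the `k`-th power of the translation maps the first coordinate `x` to `x + k`
  refine derivation_eq_of_iterate (b := fun i => if i = 0 then c (X 0) else 1) (N := 2) hD hexp
    one_lt_two fun k => ?_
  have : t.unop^[k] (c (X 0)) = c (X 0) + (k : PolyRing 3) := by
    induction k with
    | zero => simp
    | succ k ih =>
      rw [Function.iterate_succ_apply', ih, map_add, h0, map_natCast]
      push_cast
      ring
  rw [this]
  simp [Finset.sum_range_succ, smul_eq_C_mul]

theorem AutA.ext_coordinates (c : PolyRing 3 ≃ₐ[ℂ] PolyRing 3) {g h : AutA 3}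
    (h0 : g.unop (c (X 0)) = h.unop (c (X 0)))
    (h1 : ∀ p : PolyRing 2, g.unop (c (rename Fin.succ p)) = h.unop (c (rename Fin.succ p))) :
    g = h := by
  have : ((g.unop : PolyRing 3 →ₐ[ℂ] PolyRing 3).comp (c : PolyRing 3 →ₐ[ℂ] PolyRing 3)) =
      (h.unop : PolyRing 3 →ₐ[ℂ] PolyRing 3).comp (c : PolyRing 3 →ₐ[ℂ] PolyRing 3) :=
    algHom_ext_succ h0 h1
  refine AutA.ext_X fun j => ?_
  simpa using DFunLike.congr_fun this (c.symm (X j))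

theorem mem_cent_iff {n : ℕ} {u g : AutA n} : g ∈ Cent u ↔ g * u = u * g := by
  rw [Subgroup.mem_centralizer_singleton_iff]

theorem Cent.unop_comm {n : ℕ} {u : AutA n} (g : Cent u) (h : PolyRing n) :
    u.unop ((g : AutA n).unop h) = (g : AutA n).unop (u.unop h) := by
  have := congrArg (fun k : AutA n => k.unop h) (mem_cent_iff.1 g.2)
  simpa only [MulOpposite.unop_mul, AlgEquiv.mul_apply] using this

/-- An automorphism commuting with `Exp(D)` commutes with `D`. -/
theorem Cent.derivation_apply {n : ℕ} {u : AutA n} {D : Der n} (hD : IsLocallyNilpotent D)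
    (hu : IsExp D u) (g : Cent u) (h : PolyRing n) :
    D ((g : AutA n).unop h) = (g : AutA n).unop (D h) := by
  obtain ⟨m, hm⟩ := hD h
  have hm' := iterate_eq_zero_of_le hm (Nat.le_add_right m 2)
  have hcomm : Function.Commute u.unop (g : AutA n).unop := fun h => Cent.unop_comm g h
  have := derivation_eq_of_iterate (N := m + 2) (f := (g : AutA n).unop h)
    (b := fun i => (g : AutA n).unop ((i.factorial : ℂ)⁻¹ • D^[i] h)) hD hu (by omega) fun k => by
      rw [(hcomm.iterate_left k).eq, hu.iterate_apply hm' k, map_sum]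
      simp only [map_smul]
  rw [this]
  simp

/-- The modifications of `Exp(α D₀)`, for a non-zero constant `α`, are the `Exp(h D₀)` with
`h ∈ ker D₀`. -/
theorem exists_isModification_iff {u' : AutA 3} (hD : IsLocallyNilpotent D₀) {α : ℂ} (hα : α ≠ 0)
    (hu' : IsExp ((C α : PolyRing 3) • D₀) u') {g : AutA 3} :
    (∃ h, IsModification h u' g) ↔ ∃ h, D₀ h = 0 ∧ IsExp (h • D₀) g := by
  have hα' : D₀ (C α) = 0 := derivation_C D₀ α
  have hC : (C α : PolyRing 3) ≠ 0 := by simpa using hα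
  constructor
  · rintro ⟨h, D₁, hD₁, hu₁, hh, hg⟩
    obtain rfl := IsExp.derivation_unique hD₁ hu₁ (hD.smul hα') hu'
    refine ⟨h * C α, ?_, by rwa [mul_smul]⟩
    have : D₀ h = 0 := (mul_eq_zero.1 hh).resolve_left hC
    rw [Derivation.leibniz, this, hα', smul_zero, smul_zero, add_zero]
  · rintro ⟨h, hh, hg⟩
    refine ⟨h * C α⁻¹, (C α : PolyRing 3) • D₀, hD.smul hα', hu', ?_, ?_⟩
    · have : D₀ (C α⁻¹) = 0 := derivation_C D₀ _
      rw [Derivation.smul_apply, Derivation.leibniz, hh, this, smul_zero, smul_zero, add_zero,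
        smul_zero]
    · rwa [smul_smul, mul_assoc, ← C_mul, inv_mul_cancel₀ hα, C_1, mul_one]

theorem mem_invariants_iff_of_smul (hD : IsLocallyNilpotent D₀) (hf : D₀ f = 0) (hf0 : f ≠ 0)
    (hu : IsExp (f • D₀) u) (h : PolyRing 3) : h ∈ invariants u ↔ D₀ h = 0 := by
  rw [mem_invariants_iff (hD.smul hf) hu, Derivation.smul_apply, smul_eq_mul, mul_eq_zero]
  simp [hf0]

/-- The plinth ideal of `Exp(f D₀)` is generated by `f` when `D₀` has a slice. -/
theorem plinthIdeal_eq_span (hc : IsStraightening D₀ c) (hD₀ : IsLocallyNilpotent D₀)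
    (hf : D₀ f = 0) (hf0 : f ≠ 0)
    (hD : IsLocallyNilpotent D) (hu : IsExp D u) (hDf : D = f • D₀) {a : invariants u}
    (ha : (a : PolyRing 3) = f) : plinthIdeal hD hu = Ideal.span {a} := by
  subst hDf
  have hinv := mem_invariants_iff_of_smul hD₀ hf hf0 hu
  ext b
  rw [Ideal.mem_span_singleton]
  constructor
  · rintro ⟨h, hh⟩
    rw [Derivation.smul_apply, smul_eq_mul] at hh
    have hb : D₀ (b : PolyRing 3) = 0 := (hinv _).1 b.2
    rw [← hh, Derivation.leibniz, hf, smul_zero, add_zero, smul_eq_mul] at hb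
    refine ⟨⟨D₀ h, (hinv _).2 ((mul_eq_zero.1 hb).resolve_left hf0)⟩, Subtype.ext ?_⟩
    exact hh.symm.trans (congrArg (· * D₀ h) ha.symm)
  · rintro ⟨k, rfl⟩
    have hk : D₀ (k : PolyRing 3) = 0 := (hinv _).1 k.2
    refine ⟨k * c (X 0), ?_⟩
    rw [Derivation.smul_apply, Derivation.leibniz, hk, hc.apply_zero, smul_zero, add_zero]
    simp [ha]

theorem isUnit_eq_algebraMap {R : Type*} [CommRing R] [Algebra ℂ R] {n : ℕ}
    (v : PolyRing n ≃ₐ[ℂ] R) (r : R) (hr : IsUnit r) : ∃ z : ℂ, r = algebraMap ℂ R z := by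
  obtain ⟨z, -, hz⟩ := isUnit_iff_eq_C_of_isReduced.1 (hr.map v.symm)
  refine ⟨z, ?_⟩
  rw [← v.apply_symm_apply r, hz, ← algebraMap_eq, AlgEquiv.commutes]

/-- An element of the centralizer of `Exp(f D₀)` multiplies `f` by a constant `z`, and maps the
slice of `D₀` to `z` times itself up to an element of `ker D₀`. -/
theorem Cent.exists_const (hc : IsStraightening D₀ c) (hD : IsLocallyNilpotent D₀)
    (hf : D₀ f = 0) (hf0 : f ≠ 0) (hu : IsExp (f • D₀) u) (g : Cent u) :
    ∃ z : ℂ, (g : AutA 3).unop f = z • f ∧ D₀ ((g : AutA 3).unop (c (X 0))) = C z := by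
  -- apply `g* (f D₀) = (f D₀) g*` to the slice
  have key : ∀ g : Cent u, (g : AutA 3).unop f = f * D₀ ((g : AutA 3).unop (c (X 0))) := fun g => by
    have := Cent.derivation_apply (hD.smul hf) hu g (c (X 0))
    rw [Derivation.smul_apply, Derivation.smul_apply, hc.apply_zero, smul_eq_mul, smul_eq_mul,
      mul_one] at this
    exact this.symm
  obtain ⟨z, hz⟩ := isUnit_eq_algebraMap (AlgEquiv.refl : PolyRing 3 ≃ₐ[ℂ] PolyRing 3)
    (D₀ ((g : AutA 3).unop (c (X 0)))) (by
      refine IsUnit.of_mul_eq_one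
        ((g : AutA 3).unop (D₀ (((g⁻¹ : Cent u) : AutA 3).unop (c (X 0))))) ?_
      refine mul_left_cancel₀ hf0 ?_
      rw [← mul_assoc, ← key, ← map_mul, ← key, mul_one]
      exact unop_unop_inv _ _)
  rw [algebraMap_eq] at hz
  exact ⟨z, by rw [key, hz, smul_eq_C_mul, mul_comm], hz⟩

/-- The kernel of the action of the centralizer of `Exp(f D₀)` on the quotient consists of the
`Exp(h D₀)` with `h ∈ ker D₀`. -/
theorem quotientHom_eq_one_iff (hc : IsStraightening D₀ c) (hD : IsLocallyNilpotent D₀)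
    (hf : D₀ f = 0) (hf0 : f ≠ 0) (hu : IsExp (f • D₀) u) (g : Cent u) :
    quotientHom u g = 1 ↔ ∃ h, D₀ h = 0 ∧ IsExp (h • D₀) (g : AutA 3) := by
  have hinv := mem_invariants_iff_of_smul hD hf hf0 hu
  constructor
  · intro hg
    have hfix : ∀ h, D₀ h = 0 → (g : AutA 3).unop h = h := fun h hh => by
      rw [← quotientHom_apply u g ⟨h, (hinv h).2 hh⟩, hg]
      rfl
    obtain ⟨z, hz, hz'⟩ := Cent.exists_const hc hD hf hf0 hu g
    have hz1 : z = 1 := by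
      rw [hfix f hf] at hz
      exact (smul_left_injective ℂ hf0 ((one_smul ℂ f).trans hz)).symm
    rw [hz1, C_1] at hz'
    refine ⟨(g : AutA 3).unop (c (X 0)) - c (X 0), ?_, ?_⟩
    · rw [map_sub, hz', hc.apply_zero, sub_self]
    set h := (g : AutA 3).unop (c (X 0)) - c (X 0) with hh
    have hDh : D₀ h = 0 := by rw [hh, map_sub, hz', hc.apply_zero, sub_self]
    -- `g* X₀ = X₀ + h`, and `g*` fixes the other two coordinates
    refine isExp_of_coordinates (hD.smul hDh) c fun j => ?_
    refine Fin.cases ?_ (fun k => ?_) j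
    · rw [finsum_exp_of_sq_eq_zero]
      · simp [hc.apply_zero, hh]
      · simp [hc.apply_zero, hDh]
    · have hk := hc.apply_succ k
      rw [finsum_exp_of_sq_eq_zero]
      · simp [hk, hfix]
      · simp [hk]
  · rintro ⟨h, hh, hg⟩
    apply MulOpposite.unop_injective
    ext b
    rw [quotientHom_apply, hg.apply_of_eq_zero]
    · rfl
    · rw [Derivation.smul_apply, (hinv _).1 b.2, smul_zero]

/-- Two exponentials of multiples of `D₀` by elements of its kernel commute. -/
theorem IsExp.mem_cent (hc : IsStraightening D₀ c) (hf : D₀ f = 0) (hu : IsExp (f • D₀) u)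
    {g : AutA 3} {h : PolyRing 3} (hh : D₀ h = 0) (hg : IsExp (h • D₀) g) : g ∈ Cent u := by
  have hu0 : u.unop (c (X 0)) = c (X 0) + f := by
    rw [hu.apply_of_sq_eq_zero] <;> simp [hc.apply_zero, hf]
  have hg0 : g.unop (c (X 0)) = c (X 0) + h := by
    rw [hg.apply_of_sq_eq_zero] <;> simp [hc.apply_zero, hh]
  have hu1 : ∀ b, D₀ b = 0 → u.unop b = b := fun b hb => hu.apply_of_eq_zero (by simp [hb])
  have hg1 : ∀ b, D₀ b = 0 → g.unop b = b := fun b hb => hg.apply_of_eq_zero (by simp [hb])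
  rw [mem_cent_iff]
  refine AutA.ext_coordinates c ?_ fun p => ?_
  · simp only [MulOpposite.unop_mul, AlgEquiv.mul_apply, hu0, hg0, map_add, hu1 h hh, hg1 f hf]
    ring
  · have := hc.apply_rename p
    simp only [MulOpposite.unop_mul, AlgEquiv.mul_apply, hu1 _ this, hg1 _ this]

end Centralizer

/-! ### Split exact sequences of ind-groups -/

section SplitExact

variable {G Q : Type*} [Group G] [Group Q] {VG : IndData G} {VQ : IndData Q}

theorem IndData.isClosed_univ {X : Type*} (V : IndData X) : V.IsClosed Set.univ :=
  fun _ => ⟨∅, Set.empty_subset _, by ext; simp⟩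

/-- A homomorphism `p` of ind-groups (embedded in automorphism groups of affine spaces) with
a section `s` gives a split exact sequence. The kernel is the locus `p = 1` and the image of `s` is
the locus `s ∘ p = id`, so both are closed. -/
theorem isSplitShortExact_of_section (hG : IsIndGroup VG) (hQ : IsIndGroup VQ) {m n : ℕ}
    {j : G →* AutA n} (hj : Function.Injective j) (hjm : IsMorphism VG (indAutA n) j)
    {q : Q →* AutA m} (hq : Function.Injective q) (hqm : IsMorphism VQ (indAutA m) q)
    {p : G →* Q} (hp : IsMorphism VG VQ p) {s : Q →* G} (hs : IsMorphism VQ VG s)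
    (hps : p.comp s = MonoidHom.id Q) {N : Subgroup G} (hN : N = p.ker) :
    IsSplitShortExact (VG.comap N.subtype) VG VQ N.subtype p ∧
      ∃ H : Subgroup G, VG.IsClosed (H : Set G) ∧ ∃ e : H ≃* Q, (∀ h : H, e h = p h) ∧
        IsIndGroupIso (VG.comap H.subtype) VQ e := by
  have hps' : ∀ x, p (s x) = x := fun x => DFunLike.congr_fun hps x
  have hNc : VG.IsClosed (N : Set G) := by
    have := (hqm.comp hp).isClosed_eq (isMorphism_const_indAutA (q 1))
    convert this using 1
    ext g
    simp [hN, MonoidHom.mem_ker, hq.eq_iff' (map_one q)]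
  have hHc : VG.IsClosed (s.range : Set G) := by
    have := (hjm.comp (hs.comp hp)).isClosed_eq hjm
    convert this using 1
    ext g
    simp only [SetLike.mem_coe, MonoidHom.mem_range, Function.comp_apply, Set.mem_ofPred_eq,
      hj.eq_iff]
    exact ⟨by rintro ⟨x, rfl⟩; rw [hps'], fun h => ⟨_, h⟩⟩
  have hrange : Set.range N.subtype = N := by simp
  refine ⟨?_, s.range, hHc, ?_⟩
  · refine
      { indGroup_left := hG.comap N.subtype_injective (hrange ▸ hNc)
        indGroup_mid := hG
        indGroup_right := hQ
        injective := N.subtype_injective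
        morphism_left := isMorphism_comap _ _
        closed_range := by rwa [Subgroup.range_subtype]
        iso_range := ⟨?_, ?_⟩
        exact := by rw [Subgroup.range_subtype, hN]
        morphism_right := hp
        surjective := fun x => ⟨s x, hps' x⟩
        split := ⟨s, hs, hps⟩ }
    · rw [isMorphism_comap_iff]
      exact isMorphism_comap VG N.subtype
    · rw [isMorphism_comap_iff]
      convert isMorphism_comap VG N.subtype.range.subtype using 1
      funext x
      exact MonoidHom.apply_ofInjective_symm _ x
  · have hsinj : Function.Injective s := Function.LeftInverse.injective hps'
    let e := MonoidHom.ofInjective hsinj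
    have he : ∀ h : s.range, e.symm h = p h := fun h => by
      obtain ⟨x, rfl⟩ := e.surjective h
      rw [MulEquiv.symm_apply_apply]
      exact (hps' x).symm
    refine ⟨e.symm, he, ?_, ?_⟩
    · convert hp.comp (isMorphism_comap VG s.range.subtype) using 1
      funext h
      exact he h
    · rw [isMorphism_comap_iff]
      exact hs

end SplitExact

/-! ### The section of the action on the quotient -/

section Section

/-- The automorphism of `𝔸³` that, in the coordinates `c`, multiplies the first coordinate by `z`
and acts by `φ` on the other two. -/
def extendAut (c : PolyRing 3 ≃ₐ[ℂ] PolyRing 3) : ℂˣ × AutA 2 →* AutA 3 where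
  toFun x := MulOpposite.op (c.symm.trans ((extendEquiv x.1 x.2.unop).trans c))
  map_one' := by
    refine AutA.ext_coordinates c ?_ fun p => ?_ <;>
    · change c (extendEquiv 1 1 (c.symm (c _))) = _
      rw [AlgEquiv.symm_apply_apply, extendEquiv_one]
      rfl
  map_mul' x y := by
    apply MulOpposite.unop_injective
    apply AlgEquiv.ext
    intro p
    change c (extendEquiv (x.1 * y.1) (y.2.unop * x.2.unop) (c.symm p)) =
      c (extendEquiv y.1 y.2.unop (c.symm (c (extendEquiv x.1 x.2.unop (c.symm p)))))
    rw [AlgEquiv.symm_apply_apply, mul_comm, extendEquiv_mul]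

theorem extendAut_unop (c : PolyRing 3 ≃ₐ[ℂ] PolyRing 3) (x : ℂˣ × AutA 2) (p : PolyRing 3) :
    (extendAut c x).unop p = c (extendHom x.1 (x.2.unop : PolyRing 2 →ₐ[ℂ] PolyRing 2)
      (c.symm p)) := rfl

theorem extendAut_X_zero (c : PolyRing 3 ≃ₐ[ℂ] PolyRing 3) (x : ℂˣ × AutA 2) :
    (extendAut c x).unop (c (X 0)) = C (x.1 : ℂ) * c (X 0) := by
  rw [extendAut_unop, AlgEquiv.symm_apply_apply, extendHom_X_zero, map_mul, ← algebraMap_eq,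
    AlgEquiv.commutes]

theorem extendAut_rename (c : PolyRing 3 ≃ₐ[ℂ] PolyRing 3) (x : ℂˣ × AutA 2) (p : PolyRing 2) :
    (extendAut c x).unop (c (rename Fin.succ p)) = c (rename Fin.succ (x.2.unop p)) := by
  rw [extendAut_unop, AlgEquiv.symm_apply_apply, extendHom_rename]
  rfl

theorem regularFamily_extendAut {G : Type*} {V : IndData G} (c : PolyRing 3 ≃ₐ[ℂ] PolyRing 3)
    {z : G → ℂˣ} {φ : G → AutA 2}
    (hz : V.RegularFamily fun x => (C (z x : ℂ) : PolyRing 3))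
    (hφ : ∀ j, V.RegularFamily fun x => (φ x).unop (X j)) (p : PolyRing 3) :
    V.RegularFamily fun x => (extendAut c (z x, φ x)).unop p := by
  simp only [extendAut_unop]
  refine IndData.RegularFamily.algHom ?_ (c : PolyRing 3 →ₐ[ℂ] PolyRing 3)
  have : ∀ x, extendHom (z x) ((φ x).unop : PolyRing 2 →ₐ[ℂ] PolyRing 2) (c.symm p) =
      aeval (fun i => (Fin.cons (C (z x : ℂ) * X 0)
        (fun j => rename Fin.succ ((φ x).unop (X j))) : Fin 3 → PolyRing 3) i) (c.symm p) :=
    fun x => rfl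
  simp only [this]
  refine (IndData.RegularFamily.const (c.symm p)).aeval fun i => ?_
  refine Fin.cases ?_ (fun j => ?_) i
  · exact hz.mul (.const _)
  · exact (hφ j).algHom (rename Fin.succ)

end Section

/-! ### The ind-groups of the exact sequence -/

section IndGroups

theorem isClosed_cent {n : ℕ} (u : AutA n) : (indAutA n).IsClosed (Cent u : Set (AutA n)) := by
  have h1 : IsMorphism (indAutA n) (indAutA n) fun g => g * u :=
    (IsMorphism.id _).mul_indAutA (isMorphism_const_indAutA u)
  have h2 : IsMorphism (indAutA n) (indAutA n) fun g => u * g :=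
    (isMorphism_const_indAutA u).mul_indAutA (IsMorphism.id _)
  convert h1.isClosed_eq h2 using 1
  ext g
  exact mem_cent_iff

theorem isIndGroup_cent {n : ℕ} (u : AutA n) : IsIndGroup ((indAutA n).comap (Cent u).subtype) :=
  (isIndGroup_indAutA n).comap (Cent u).subtype_injective (by simpa using isClosed_cent u)

variable {R : Type*} [CommRing R] [Algebra ℂ R] (v : PolyRing 2 ≃ₐ[ℂ] R)

/-- The identification of `Aut(Spec R)` with `Aut(𝔸²)` given by coordinates. -/
def planeEquiv : AutSpec R ≃* AutA 2 := (MulEquiv.op (AlgEquiv.autCongr v)).symm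

theorem planeEquiv_unop (g : AutSpec R) (p : PolyRing 2) :
    (planeEquiv v g).unop p = v.symm (g.unop (v p)) := rfl

theorem planeEquiv_inv_unop (g : AutSpec R) (p : PolyRing 2) :
    (planeEquiv v g)⁻¹.unop p = v.symm (g⁻¹.unop (v p)) := rfl

theorem isMorphism_planeEquiv : IsMorphism (indAutPlane v) (indAutA 2) (planeEquiv v) :=
  isMorphism_comap _ _

theorem isMorphism_indAutPlane_iff {G : Type*} {V : IndData G} {h : G → AutSpec R} :
    IsMorphism V (indAutPlane v) h ↔ IsMorphism V (indAutA 2) fun x => planeEquiv v (h x) :=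
  isMorphism_comap_iff

theorem isMorphism_inv_comap_indAutPlane (Q : Subgroup (AutSpec R)) :
    IsMorphism ((indAutPlane v).comap Q.subtype) ((indAutPlane v).comap Q.subtype)
      fun x => x⁻¹ := by
  rw [isMorphism_comap_iff, isMorphism_indAutPlane_iff]
  exact ((isMorphism_planeEquiv v).comp (isMorphism_comap _ Q.subtype)).inv_indAutA

theorem isIndGroup_indAutPlane : IsIndGroup (indAutPlane v) :=
  (isIndGroup_indAutA 2).comap (f := (planeEquiv v : AutSpec R →* AutA 2)) (planeEquiv v).injective
    (by
      have : Set.range (planeEquiv v : AutSpec R →* AutA 2) = Set.univ :=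
        (planeEquiv v).surjective.range_eq
      rw [this]
      exact IndData.isClosed_univ _)

variable [IsDomain R] {a : R}

/-- The stabilizer of the curve `a = 0` in the plane is closed: `g* a` is a multiple of `a` iff
the coefficients of both are proportional. -/
theorem isClosed_autPreserving (ha : a ≠ 0) :
    (indAutPlane v).IsClosed (autPreserving (Ideal.span {a}) : Set (AutSpec R)) := by
  have hb0 : v.symm a ≠ 0 := (map_ne_zero_iff _ v.symm.injective).2 ha
  obtain ⟨m, hm⟩ := ne_zero_iff.1 hb0
  have hreg := (isMorphism_planeEquiv v).regularFamily (v.symm a)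
  have := ((IndData.RegularFamily.const (V := indAutPlane v)
    (C (coeff m (v.symm a)) : PolyRing 2)).mul hreg).isClosed_eq
    ((hreg.C_coeff m).mul (.const (v.symm a)))
  convert this using 1
  ext g
  rw [SetLike.mem_coe, mem_autPreserving_span_iff (isUnit_eq_algebraMap v) ha, Set.mem_ofPred_eq,
    planeEquiv_unop, AlgEquiv.apply_symm_apply]
  constructor
  · rintro ⟨z, hz⟩
    rw [hz, map_smul, coeff_smul, smul_eq_C_mul, smul_eq_mul, C_mul]
    ring
  · intro h
    refine ⟨(coeff m (v.symm a))⁻¹ * coeff m (v.symm (g.unop a)), v.symm.injective ?_⟩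
    rw [map_smul, smul_eq_C_mul, C_mul, mul_assoc, ← h, ← mul_assoc, ← C_mul, inv_mul_cancel₀ hm,
      C_1, one_mul]

theorem isIndGroup_autPreserving (ha : a ≠ 0) :
    IsIndGroup ((indAutPlane v).comap (autPreserving (Ideal.span {a})).subtype) :=
  (isIndGroup_indAutPlane v).comap (Subgroup.subtype_injective _)
    (by simpa using isClosed_autPreserving v ha)

end IndGroups

/-! ### The exact sequence of a modified translation -/

section Main

variable {u : AutA 3} {D₀ : Der 3} {c : PolyRing 3 ≃ₐ[ℂ] PolyRing 3} {f : PolyRing 3}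

/-- The centralizer acts on the quotient plane by a morphism of ind-groups: the coordinates of the
quotient extend to a retraction of the polynomial ring, so the components of the action are
obtained from those of `g` by substitution. -/
theorem isMorphism_quotientHom (v : PolyRing 2 ≃ₐ[ℂ] invariants u)
    (hv : ∀ p, (v p : PolyRing 3) = c (rename Fin.succ p)) :
    IsMorphism ((indAutA 3).comap (Cent u).subtype) (indAutPlane v) (quotientHom u) := by
  let r : PolyRing 3 →ₐ[ℂ] PolyRing 2 :=
    (aeval (Fin.cons 0 X : Fin 3 → PolyRing 2)).comp (c.symm : PolyRing 3 →ₐ[ℂ] PolyRing 3)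
  have hr : ∀ b : invariants u, v.symm b = r b := fun b => by
    obtain ⟨p, rfl⟩ := v.surjective b
    rw [v.symm_apply_apply, hv]
    have hX : (Fin.cons 0 X : Fin 3 → PolyRing 2) ∘ Fin.succ = X := rfl
    rw [AlgHom.comp_apply, AlgEquiv.coe_toAlgHom, AlgEquiv.symm_apply_apply, aeval_rename, hX,
      aeval_X_left_apply]
  have hcent := isMorphism_comap (indAutA 3) (Cent u).subtype
  rw [isMorphism_indAutPlane_iff]
  refine isMorphism_indAutA (fun j => ?_) fun j => ?_
  · have : ∀ g : Cent u, (planeEquiv v (quotientHom u g)).unop (X j) =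
        r ((g : AutA 3).unop (v (X j))) := fun g => by
      rw [planeEquiv_unop, hr, quotientHom_apply]
    simp only [this]
    exact (hcent.regularFamily _).algHom r
  · have : ∀ g : Cent u, (planeEquiv v (quotientHom u g))⁻¹.unop (X j) =
        r ((g : AutA 3)⁻¹.unop (v (X j))) := fun g => by
      rw [planeEquiv_inv_unop, hr, ← map_inv, quotientHom_apply, Subgroup.coe_inv]
    simp only [this]
    exact (hcent.regularFamily_inv _).algHom r

/-- In coordinates `c` straightening `D₀` and adapted to the coordinates `v` of the quotient, the
centralizer of `u = Exp(f D₀)` acts on the plane with a section: an automorphism `φ` of the plane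
with `φ* f = z f` lifts to the automorphism multiplying the slice by `z` and acting by `φ` on the
other two coordinates. -/
theorem split_of_straightening (hc : IsStraightening D₀ c) (hf : D₀ f = 0) (hf0 : f ≠ 0)
    (hu : IsExp (f • D₀) u) {a : invariants u} (ha : (a : PolyRing 3) = f)
    (v : PolyRing 2 ≃ₐ[ℂ] invariants u)
    (hv : ∀ p, (v p : PolyRing 3) = c (rename Fin.succ p))
    (hp : ∀ g, quotientHom u g ∈ autPreserving (Ideal.span {a})) {N : Subgroup (Cent u)}
    (hN : N = (quotientHom u).ker) :
    IsSplitShortExact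
      (((indAutA 3).comap (Cent u).subtype).comap N.subtype)
      ((indAutA 3).comap (Cent u).subtype)
      ((indAutPlane v).comap (autPreserving (Ideal.span {a})).subtype)
      N.subtype
      ((quotientHom u).codRestrict (autPreserving (Ideal.span {a})) hp) ∧
    ∃ H : Subgroup (Cent u),
      ((indAutA 3).comap (Cent u).subtype).IsClosed (H : Set (Cent u)) ∧
      ∃ e : H ≃* autPreserving (Ideal.span {a}),
        (∀ h : H, (e h : AutSpec (invariants u)) = quotientHom u h) ∧
        IsIndGroupIso
          (((indAutA 3).comap (Cent u).subtype).comap H.subtype)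
          ((indAutPlane v).comap (autPreserving (Ideal.span {a})).subtype) e := by
  have ha0 : a ≠ 0 := by
    rintro rfl
    exact hf0 ha.symm
  set Q := autPreserving (Ideal.span {a}) with hQ
  set VQ := (indAutPlane v).comap Q.subtype with hVQ
  have hQG : IsIndGroup VQ := isIndGroup_autPreserving v ha0
  let q : Q →* AutA 2 := (planeEquiv v : AutSpec (invariants u) →* AutA 2).comp Q.subtype
  have hqm : IsMorphism VQ (indAutA 2) q := (isMorphism_planeEquiv v).comp (isMorphism_comap _ _)
  have hinv : IsMorphism VQ VQ fun x => x⁻¹ := isMorphism_inv_comap_indAutPlane v Q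
  obtain ⟨χ, hχ⟩ := exists_character (isUnit_eq_algebraMap v) ha0
  have hb0 : v.symm a ≠ 0 := (map_ne_zero_iff _ v.symm.injective).2 ha0
  obtain ⟨m, hm⟩ := ne_zero_iff.1 hb0
  -- `χ x` is the quotient of two coefficients at a monomial occurring in the equation `a`
  have hχm : VQ.RegularFamily fun x => (C (χ x : ℂ) : PolyRing 3) := by
    convert ((hqm.regularFamily (v.symm a)).C_coeff (τ := Fin 3) m).mul
      (.const (C (coeff m (v.symm a))⁻¹)) using 2 with x
    have : (q x).unop (v.symm a) = (χ x : ℂ) • v.symm a := by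
      change v.symm ((x : AutSpec (invariants u)).unop (v (v.symm a))) = _
      rw [AlgEquiv.apply_symm_apply, hχ, map_smul]
    rw [this, coeff_smul, ← C_mul, smul_eq_mul, mul_assoc, mul_inv_cancel₀ hm, mul_one]
  let s₀ : Q →* AutA 3 := (extendAut c).comp (χ.prod q)
  have hs₀ : ∀ x p, ((s₀ x).unop (c (rename Fin.succ p))) = c (rename Fin.succ ((q x).unop p)) :=
    fun x p => extendAut_rename c _ p
  have hs₀v : ∀ x (b : invariants u), (s₀ x).unop b =
      ((x : AutSpec (invariants u)).unop b : invariants u) := fun x b => by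
    obtain ⟨p, rfl⟩ := v.surjective b
    rw [hv, hs₀, ← hv]
    exact congrArg Subtype.val (v.apply_symm_apply _)
  have hs₀m : IsMorphism VQ (indAutA 3) s₀ := by
    have h1 : ∀ p, VQ.RegularFamily fun x => (s₀ x).unop p :=
      regularFamily_extendAut c hχm fun j => hqm.regularFamily (X j)
    refine isMorphism_indAutA (fun j => h1 _) fun j => ?_
    have := (h1 (X j)).comp hinv
    simpa only [map_inv] using this
  have hs₀c : ∀ x, s₀ x ∈ Cent u := fun x => by
    have hu0 : u.unop (c (X 0)) = c (X 0) + f := by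
      rw [hu.apply_of_sq_eq_zero] <;> simp [hc.apply_zero, hf]
    have hsx : (s₀ x).unop (c (X 0)) = C (χ x : ℂ) * c (X 0) := extendAut_X_zero c _
    have hsf : (s₀ x).unop f = C (χ x : ℂ) * f := by
      rw [← ha, hs₀v, hχ]
      simp [smul_eq_C_mul]
    have hC : u.unop (C (χ x : ℂ)) = C (χ x : ℂ) := by
      rw [← algebraMap_eq, AlgEquiv.commutes]
    have hu1 : ∀ p : PolyRing 2, u.unop (c (rename Fin.succ p)) = c (rename Fin.succ p) :=
      fun p => by
        rw [← hv]
        exact (v p).2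
    rw [mem_cent_iff]
    refine AutA.ext_coordinates c ?_ fun p => ?_
    · simp only [MulOpposite.unop_mul, AlgEquiv.mul_apply, hu0, hsx, map_add, map_mul, hC, hsf]
      ring
    · simp only [MulOpposite.unop_mul, AlgEquiv.mul_apply, hs₀, hu1]
  let P := (quotientHom u).codRestrict Q hp
  let s : Q →* Cent u := s₀.codRestrict (Cent u) hs₀c
  have hs : IsMorphism VQ ((indAutA 3).comap (Cent u).subtype) s := by
    rw [isMorphism_comap_iff]
    exact hs₀m
  have hps : P.comp s = MonoidHom.id Q := by
    ext x : 1
    apply Subtype.ext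
    apply MulOpposite.unop_injective
    ext b
    exact congrArg _ (hs₀v x b)
  have hP : IsMorphism ((indAutA 3).comap (Cent u).subtype) VQ P := by
    rw [hVQ, isMorphism_comap_iff]
    exact isMorphism_quotientHom v hv
  have hNP : N = P.ker := by
    rw [hN]
    ext g
    simp only [MonoidHom.mem_ker]
    exact ⟨fun h => Subtype.ext h, fun h => congrArg Subtype.val h⟩
  obtain ⟨h1, H, hH, e, he, he'⟩ := isSplitShortExact_of_section (isIndGroup_cent u) hQG
    (j := (Cent u).subtype) (Cent u).subtype_injective (isMorphism_comap _ _)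
    (q := q) ((planeEquiv v).injective.comp Q.subtype_injective) hqm hP hs hps hNP
  exact ⟨h1, H, hH, e, fun h => congrArg Subtype.val (he h), he'⟩

/-- If `d • D₁ = f • D₀` with `D₁` the derivation of an irreducible unipotent automorphism, and
`D₀` has a slice, then `D₁` is a constant multiple of `D₀`: the value of `D₁` on the slice
divides `f`, and is constant by irreducibility. -/
theorem exists_const_of_isIrreducible {t u' : AutA 3} {d : PolyRing 3} {D₁ : Der 3}
    (hc : IsStraightening D₀ c) (hD : IsLocallyNilpotent D₀) (ht : IsExp D₀ t) (hf : D₀ f = 0)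
    (hf0 : f ≠ 0) (hirr : IsIrreducible u') (hu' : IsExp D₁ u') (hd : D₁ d = 0)
    (hdf : d • D₁ = f • D₀) : ∃ α : ℂ, α ≠ 0 ∧ IsExp ((C α : PolyRing 3) • D₀) u' := by
  set b := D₁ (c (X 0)) with hb
  have hdb : d * b = f := by
    have := DFunLike.congr_fun hdf (c (X 0))
    simpa [hc.apply_zero] using this
  have hd0 : d ≠ 0 := left_ne_zero_of_mul (hdb ▸ hf0)
  have hb0 : b ≠ 0 := right_ne_zero_of_mul (hdb ▸ hf0)
  have hD₁ : D₁ = b • D₀ := by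
    refine Derivation.ext fun h => mul_left_cancel₀ hd0 ?_
    have := DFunLike.congr_fun hdf h
    simpa [← hdb, mul_assoc] using this
  have hd' : D₀ d = 0 := by
    have : b * D₀ d = 0 := by simpa [hD₁] using hd
    exact (mul_eq_zero.1 this).resolve_left hb0
  have hb' : D₀ b = 0 := by
    have : D₀ (d * b) = 0 := by rw [hdb, hf]
    rw [Derivation.leibniz, hd', smul_zero, add_zero, smul_eq_mul] at this
    exact (mul_eq_zero.1 this).resolve_left hd0
  obtain ⟨α, hα, hbα⟩ := hirr.2.2 b t ⟨D₀, hD, ht, hb', hD₁ ▸ hu'⟩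
  exact ⟨α, hα, by rwa [← hbα, ← hD₁]⟩

/-- `Exp(f D₀)` is a translation if `f` is a non-zero constant: rescale the slice. -/
theorem isTranslation_of_const (hc : IsStraightening D₀ c) {α : ℂ} (hα : α ≠ 0)
    (hu : IsExp ((C α : PolyRing 3) • D₀) u) : IsTranslation u := by
  have hα' : D₀ (C α) = 0 := derivation_C D₀ α
  have hu1 : ∀ b, D₀ b = 0 → u.unop b = b := fun b hb => hu.apply_of_eq_zero (by simp [hb])
  have hu0 : u.unop (c (X 0)) = c (X 0) + C α := by
    rw [hu.apply_of_sq_eq_zero] <;> simp [hc.apply_zero]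
  let c' := (extendEquiv (Units.mk0 α hα)⁻¹ 1).trans c
  have h0 : c' (X 0) = C α⁻¹ * c (X 0) := by
    change c (extendEquiv _ _ _) = _
    rw [extendEquiv_apply, extendHom_X_zero, map_mul, ← algebraMap_eq, AlgEquiv.commutes]
    simp
  have h1 : ∀ j : Fin 2, c' (X j.succ) = c (X j.succ) := fun j => by
    change c (extendEquiv _ _ _) = _
    rw [extendEquiv_apply, ← rename_X Fin.succ, extendHom_rename]
    rfl
  refine ⟨c', ?_, ?_, ?_⟩
  · have hC : u.unop (C α⁻¹) = C α⁻¹ := by rw [← algebraMap_eq, AlgEquiv.commutes]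
    rw [h0, map_mul, hC, hu0, mul_add, ← C_mul, inv_mul_cancel₀ hα, C_1]
  · exact (congrArg _ (h1 0)).trans ((hu1 _ (hc.apply_succ 0)).trans (h1 0).symm)
  · exact (congrArg _ (h1 1)).trans ((hu1 _ (hc.apply_succ 1)).trans (h1 1).symm)

end Main

end IndAut

end

open IndAut
theorem mainTheorem4 (u u' : AutA 3) (d : PolyRing 3) (D : Der 3)
    (hD : IsLocallyNilpotent D) (hu : IsExp D u) (hu1 : u ≠ 1)
    (hmod : IsModifiedTranslation u) (hdec : IsStandardDecomposition u d u') :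
    -- the algebraic quotient is an affine plane, and the plinth divisor `Γ` is a divisor
    Nonempty (PolyRing 2 ≃ₐ[ℂ] invariants u) ∧
    (∃ a : invariants u, a ≠ 0 ∧ plinthIdeal hD hu = Ideal.span {a}) ∧
    -- the modifications of `u'` form a subgroup `N` of `Cent(u)`, and `Cent(u)` preserves `Γ`
    (∀ f g, IsModification f u' g → g ∈ Cent u) ∧
    (∃ (N : Subgroup (Cent u))
        (hp : ∀ g, quotientHom u g ∈ autPreserving (plinthIdeal hD hu)),
      (∀ g : Cent u, g ∈ N ↔ ∃ f, IsModification f u' (g : AutA 3)) ∧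
      -- the split short exact sequence, for any choice of coordinates of the quotient
      ∀ v : PolyRing 2 ≃ₐ[ℂ] invariants u,
        IsSplitShortExact
          (((indAutA 3).comap (Cent u).subtype).comap N.subtype)
          ((indAutA 3).comap (Cent u).subtype)
          ((indAutPlane v).comap (autPreserving (plinthIdeal hD hu)).subtype)
          N.subtype
          ((quotientHom u).codRestrict (autPreserving (plinthIdeal hD hu)) hp) ∧
        -- the closed subgroup `H` mapped isomorphically onto the quotient
        ∃ H : Subgroup (Cent u),
          ((indAutA 3).comap (Cent u).subtype).IsClosed (H : Set (Cent u)) ∧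
          ∃ e : H ≃* autPreserving (plinthIdeal hD hu),
            (∀ h : H, (e h : AutSpec (invariants u)) = quotientHom u h) ∧
            IsIndGroupIso
              (((indAutA 3).comap (Cent u).subtype).comap H.subtype)
              ((indAutPlane v).comap (autPreserving (plinthIdeal hD hu)).subtype) e) ∧
    -- the case of a translation
    (IsTranslation u ↔ plinthIdeal hD hu = ⊤) ∧
    (IsTranslation u → autPreserving (plinthIdeal hD hu) = ⊤ ∧
      ∀ g, (∃ f, IsModification f u' g) ↔ ∃ f, IsModification f u g) := by
  obtain ⟨f, t, ht, D₀, hD₀, htexp, hf, huf⟩ := hmod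
  obtain ⟨c, hc⟩ := exists_isStraightening ht hD₀ htexp
  have hDf : D = f • D₀ := IsExp.derivation_unique hD hu (hD₀.smul hf) huf
  have hf0 : f ≠ 0 := by
    rintro rfl
    refine hu1 (AutA.ext_X fun j => ?_)
    rw [huf.apply_of_eq_zero (by simp)]
    rfl
  have hinv := mem_invariants_iff_of_smul hD₀ hf hf0 huf
  obtain ⟨hirr, D₁, hD₁, hu', hd, hud⟩ := hdec
  obtain ⟨α, hα, hu'α⟩ := exists_const_of_isIrreducible hc hD₀ htexp hf hf0 hirr hu' hd
    (IsExp.derivation_unique (hD₁.smul hd) hud (hD₀.smul hf) huf)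
  have hmods : ∀ g, (∃ h, IsModification h u' g) ↔ ∃ h, D₀ h = 0 ∧ IsExp (h • D₀) g :=
    fun g => exists_isModification_iff hD₀ hα hu'α
  obtain ⟨w, -⟩ := hc.exists_planeCoordinates hinv
  let a : invariants u := ⟨f, (hinv f).2 hf⟩
  have ha0 : a ≠ 0 := fun h => hf0 (congrArg Subtype.val h)
  have hplinth : plinthIdeal hD hu = Ideal.span {a} :=
    plinthIdeal_eq_span hc hD₀ hf hf0 hD hu hDf rfl
  -- a slice `x` of `D` satisfies `f * D₀ x = 1`
  have htrans : IsTranslation u → ∃ β : ℂ, β ≠ 0 ∧ f = C β := by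
    intro htr
    obtain ⟨c₂, hc₂⟩ := exists_isStraightening htr hD hu
    have h1 : f * D₀ (c₂ (X 0)) = 1 := by simpa [hDf] using hc₂.apply_zero
    obtain ⟨β, hβ, h⟩ := isUnit_iff_eq_C_of_isReduced.1 (IsUnit.of_mul_eq_one _ h1)
    exact ⟨β, hβ.ne_zero, h⟩
  have htop : IsTranslation u → plinthIdeal hD hu = ⊤ := fun htr => by
    obtain ⟨β, hβ, hfβ⟩ := htrans htr
    rw [hplinth, Ideal.span_singleton_eq_top]
    refine IsUnit.of_mul_eq_one (algebraMap ℂ _ β⁻¹) (Subtype.ext ?_)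
    change f * algebraMap ℂ _ β⁻¹ = 1
    rw [hfβ, algebraMap_eq, ← C_mul, mul_inv_cancel₀ hβ, C_1]
  refine ⟨⟨w⟩, ⟨a, ha0, hplinth⟩, ?_, ?_, ⟨htop, ?_⟩, ?_⟩
  · intro h g hg
    obtain ⟨k, hk, hgk⟩ := (hmods g).1 ⟨h, hg⟩
    exact IsExp.mem_cent hc hf huf hk hgk
  · rw [hplinth]
    refine ⟨(quotientHom u).ker, fun g => ?_, fun g => ?_, fun v => ?_⟩
    · obtain ⟨z, hz, -⟩ := Cent.exists_const hc hD₀ hf hf0 huf g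
      exact (mem_autPreserving_span_iff (isUnit_eq_algebraMap w) ha0).2 ⟨z, Subtype.ext hz⟩
    · rw [hmods, MonoidHom.mem_ker, quotientHom_eq_one_iff hc hD₀ hf hf0 huf]
    · obtain ⟨c', hc', hv⟩ := hc.exists_adapted hinv v
      exact split_of_straightening hc' hf hf0 huf rfl v hv _ rfl
  · intro h
    rw [hplinth, Ideal.span_singleton_eq_top] at h
    obtain ⟨β, hβ⟩ := isUnit_eq_algebraMap w a h
    have hfβ : f = C β := congrArg Subtype.val hβ
    have hβ0 : β ≠ 0 := by
      rintro rfl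
      exact hf0 (hfβ.trans C_0)
    exact isTranslation_of_const hc hβ0 (hfβ ▸ huf)
  · intro htr
    obtain ⟨β, hβ, hfβ⟩ := htrans htr
    constructor
    · rw [htop htr]
      exact eq_top_iff.2 fun g _ => Ideal.comap_top
    · intro g
      rw [hmods, exists_isModification_iff hD₀ hβ (hfβ ▸ huf)]
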